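/- **Setting.** Let $(\zeta_t)_{t\in\mathbb Z}$ be i.i.d. standard complex Gaussian variables, i.e. $\zeta_t=\xi^1_t+i\xi^2_t$ with all $\xi^1_t,\xi^2_t$ independent $\mathcal N(0,1)$. For a deterministic signal $x\in\mathbb C^{\mathbb Z}$ and $\sigma>0$ we observe $y_t=x_t+\sigma\zeta_t$. Write $[u*v]_t=\sum_\tau u_\tau v_{t-\tau}$, $[\Delta x]_t=x_{t-1}$, $\|x\|_{n,2}^2=\sum_{t=0}^n|x_t|^2$, and let $\mathbb C(\mathbb Z_{0,n})$ be the set of sequences vanishing outside $[0,n]$. Let $\|\varphi\|^*_{n,1}=\sum_{k=0}^n\bigl|(n+1)^{-1/2}\sum_{t=0}^n\varphi_t e^{2\pi i kt/(n+1)}\bigr|$. Let $m\ge1$, $n=2m$, $\varrho\ge1$, $\varkappa\ge0$, $1\le s\le n+1$, and suppose: * ($x$ is $(m,n,\varrho)$-simple) there is $\phi\in\mathbb C(\mathbb Z_{0,m})$ with $\|\phi\|_2^2\le\frac{\varrho}{m+1}$ and $|x_t-[\phi*x]_t|^2\le\frac{\varrho\sigma^2}{m+1}$ for $-m\le t\le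 n$ (this holds in particular if $\mathbf E|x_t-[\phi*y]_t|^2\le\frac{\varrho\sigma^2}{m+1}$ for $-m\le t\le n$); * (approximate shift-invariance) $x=x^{\mathcal S}+\varepsilon$, where $x^{\mathcal S}$ belongs to a linear subspace $\mathcal S\subset\mathbb C^{\mathbb Z}$ with $\dim\mathcal S=s$ and $\Delta\mathcal S\subseteq\mathcal S$, and $\|\Delta^\tau\varepsilon\|_{n,2}\le\varkappa\sigma$ for $0\le\tau\le n$. Let $\widehat\varphi$ be any optimal solution of the constrained least-squares problem $$\min\Bigl\{\|y-\varphi*y\|_{n,2}^2:\ \varphi\in\mathbb C(\mathbb Z_{0,n}),\ \|\varphi\|^*_{n,1}\le\frac{2\varrho}{\sqrt{n+1}}\Bigr\}.$$ **Proposition.** There is an absolute constant $C>0$ such that the following holds in this setting. 1. For every $\alpha\in(0,1)$ there is a measurable set $\Xi_\alpha$ of noise realizations with $\mathbf P\{\zeta\in\Xi_\alpha\}\ge1-\alpha$ such that, whenever $\zeta\in\Xi_\alpha$, for every optimal solution $\widehat\varphi$ and every $t\in[m,n]$, $$\bigl|x_t-[\widehat\varphi*y]_t\bigr|^2\le C\,\frac{\sigma^2\varrho}{n+1}\Bigl[\varrho^2\bigl(1+\ln\tfrac1\alpha\bigr)+E_0\Bigr],\qquad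 E_0=\varrho\ln\frac{2n}{\alpha}+\varrho\varkappa\sqrt{1+\ln\tfrac1\alpha}+s .$$ 2. Consequently, for every (measurable) choice of the optimal solution $\widehat\varphi$ and every $t\in[m,n]$, the squared error is integrable and $$\mathbf E\bigl|x_t-[\widehat\varphi*y]_t\bigr|^2\le C\,\frac{\sigma^2\varrho}{n+1}\bigl(\varrho^2+\varrho\ln n+\varrho\varkappa+s\bigr).$$ -/

import Mathlib

open MeasureTheory ProbabilityTheory

noncomputable section

namespace LocalFilter

/-- The sequences in `ℂ(ℤ)` that vanish outside the integer interval `[k, k']`. -/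
def supportedOn (k k' : ℤ) : Set (ℤ → ℂ) :=
  {u | ∀ t : ℤ, t ∉ Set.Icc k k' → u t = 0}

/-- The convolution `[u * v]_t = ∑_τ u_τ v_{t-τ}` (it is only applied to finitely supported `u`,
for which the sum is finite). -/
def conv (u v : ℤ → ℂ) : ℤ → ℂ :=
  fun t => ∑' τ : ℤ, u τ * v (t - τ)

/-- The right shift `[Δ x]_t = x_{t-1}`. -/
def shift : (ℤ → ℂ) →ₗ[ℂ] (ℤ → ℂ) :=
  LinearMap.funLeft ℂ ℂ (fun t : ℤ => t - 1)

/-- The Euclidean norm `‖x‖_{n,2}` of `[x_0; …; x_n]`. -/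
def normTwo (n : ℕ) (x : ℤ → ℂ) : ℝ :=
  Real.sqrt (∑ t ∈ Finset.range (n + 1), ‖x (t : ℤ)‖ ^ 2)

/-- The `k`-th coordinate, `0 ≤ k ≤ n`, of the unitary discrete Fourier transform of
`[z_0; …; z_n]`. -/
def dft (n : ℕ) (z : ℤ → ℂ) (k : ℕ) : ℂ :=
  ((Real.sqrt ((n : ℝ) + 1))⁻¹ : ℂ) *
    ∑ t ∈ Finset.range (n + 1),
      z (t : ℤ) * Complex.exp (2 * Real.pi * Complex.I * k * t / (n + 1))

/-- The spectral-domain norm `‖z‖*_{n,1}`: the `ℓ₁`-norm of the discrete Fourier transform of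
`[z_0; …; z_n]`. -/
def specNormOne (n : ℕ) (z : ℤ → ℂ) : ℝ :=
  ∑ k ∈ Finset.range (n + 1), ‖dft n z k‖

/-- `ζ` is a sequence of i.i.d. standard complex Gaussian variables: the real and the imaginary
parts of all the `ζ_t` are jointly independent real variables with law `N(0, 1)`. -/
structure IsStdComplexNoise {Ω : Type*} [MeasurableSpace Ω] (ζ : ℤ → Ω → ℂ) (P : Measure Ω) :
    Prop where
  law_re : ∀ t : ℤ, HasLaw (fun ω => (ζ t ω).re) (gaussianReal 0 1) P
  law_im : ∀ t : ℤ, HasLaw (fun ω => (ζ t ω).im) (gaussianReal 0 1) P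
  indep : iIndepFun
    (fun (p : ℤ × Bool) (ω : Ω) => if p.2 then (ζ p.1 ω).re else (ζ p.1 ω).im) P

/-- The observations `y_t = x_t + σ z_t` produced by the noise realization `z`. -/
def observe (σ : ℝ) (x z : ℤ → ℂ) : ℤ → ℂ :=
  fun t => x t + (σ : ℂ) * z t

/-- `x` is `(m, n, ϱ)`-simple at noise level `σ`: some filter `φ` supported on `[0, m]` has
`‖φ‖₂² ≤ ϱ / (m+1)` and squared bias at most `ϱ σ² / (m+1)` at every point of `[-m, n]`.
This is implied by the risk bound `E |x_t - [φ * y]_t|² ≤ ϱ σ² / (m+1)` on `[-m, n]`,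
see `IsSimple.of_risk`. -/
def IsSimple (m n : ℕ) (ϱ σ : ℝ) (x : ℤ → ℂ) : Prop :=
  ∃ φ ∈ supportedOn 0 m,
    normTwo m φ ^ 2 ≤ ϱ / (m + 1) ∧
    ∀ t : ℤ, -(m : ℤ) ≤ t → t ≤ n → ‖x t - conv φ x t‖ ^ 2 ≤ ϱ * σ ^ 2 / (m + 1)

theorem conv_eq_sum {m : ℕ} {φ : ℤ → ℂ} (hφ : φ ∈ supportedOn 0 m) (v : ℤ → ℂ) (t : ℤ) :
    conv φ v t = ∑ u ∈ Finset.Icc (t - m) t, φ (t - u) * v u := by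
  have h1 : conv φ v t = ∑ j ∈ Finset.Icc (0 : ℤ) m, φ j * v (t - j) := by
    unfold conv
    refine tsum_eq_sum fun j hj => ?_
    rw [hφ j (by simpa using hj), zero_mul]
  rw [h1]
  refine Finset.sum_nbij' (fun j => t - j) (fun u => t - u) ?_ ?_ ?_ ?_ ?_
  · intro j hj
    simp only [Finset.mem_Icc] at hj ⊢
    omega
  · intro j hj
    simp only [Finset.mem_Icc] at hj ⊢
    omega
  · intro j _
    simp
  · intro j _
    simp
  · intro j _
    simp

theorem normTwo_sq_eq (m : ℕ) (φ : ℤ → ℂ) (t : ℤ) :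
    normTwo m φ ^ 2 = ∑ u ∈ Finset.Icc (t - m) t, ‖φ (t - u)‖ ^ 2 := by
  unfold normTwo
  rw [Real.sq_sqrt (Finset.sum_nonneg fun _ _ => by positivity)]
  refine Finset.sum_nbij' (fun j => t - (j : ℤ)) (fun u => (t - u).toNat) ?_ ?_ ?_ ?_ ?_
  · intro j hj
    simp only [Finset.mem_Icc, Finset.mem_range] at hj ⊢
    omega
  · intro j hj
    simp only [Finset.mem_Icc, Finset.mem_range] at hj ⊢
    omega
  · intro j _
    simp
  · intro u hu
    simp only [Finset.mem_Icc] at hu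
    omega
  · intro j _
    simp

theorem integral_sq_sub_sum {Ω ι : Type*} [MeasurableSpace Ω] {P : Measure Ω}
    [IsProbabilityMeasure P] {ξ : ι → Ω → ℝ} (hlaw : ∀ p, HasLaw (ξ p) (gaussianReal 0 1) P)
    (hind : iIndepFun ξ P) (S : Finset ι) (d : ι → ℝ) (r : ℝ) :
    Integrable (fun ω => (r - ∑ p ∈ S, d p * ξ p ω) ^ 2) P ∧
      ∫ ω, (r - ∑ p ∈ S, d p * ξ p ω) ^ 2 ∂P = r ^ 2 + ∑ p ∈ S, d p ^ 2 := by
  have hL : ∀ p, MemLp (ξ p) 2 P := fun p => by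
    have h := memLp_id_gaussianReal (μ := 0) (v := 1) 2
    rw [← (hlaw p).map_eq] at h
    exact (memLp_map_measure_iff h.1 (hlaw p).aemeasurable).1 h
  have hLd : ∀ p, MemLp (fun ω => d p * ξ p ω) 2 P := fun p => (hL p).const_mul _
  have hLs : MemLp (∑ p ∈ S, fun ω => d p * ξ p ω) 2 P := memLp_finsetSum' _ fun p _ => hLd p
  have hmean : ∀ p, ∫ ω, ξ p ω ∂P = 0 := fun p => by
    rw [(hlaw p).integral_eq]; simp
  have hvar : ∀ p, variance (ξ p) P = 1 := fun p => by
    rw [(hlaw p).variance_eq]; simp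
  have hV : variance (∑ p ∈ S, fun ω => d p * ξ p ω) P = ∑ p ∈ S, d p ^ 2 := by
    rw [IndepFun.variance_sum (fun p _ => hLd p)]
    · refine Finset.sum_congr rfl fun p _ => ?_
      rw [variance_const_mul, hvar, mul_one]
    · intro p _ q _ hpq
      exact (hind.indepFun hpq).comp (φ := fun z => d p * z) (ψ := fun z => d q * z)
        (by fun_prop) (by fun_prop)
  have hM : ∫ ω, (∑ p ∈ S, fun ω => d p * ξ p ω) ω ∂P = 0 := by
    simp only [Finset.sum_apply]
    rw [integral_finsetSum _ fun p _ => (hLd p).integrable (by norm_num)]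
    simp [integral_const_mul, hmean]
  rw [variance_eq_sub hLs, hM] at hV
  set R : Ω → ℝ := ∑ p ∈ S, fun ω => d p * ξ p ω with hR
  have hRa : ∀ ω, ∑ p ∈ S, d p * ξ p ω = R ω := fun ω => by simp [hR]
  simp only [hRa]
  have hexp : ∀ ω, (r - R ω) ^ 2 = r ^ 2 - 2 * r * R ω + (R ^ 2) ω := fun ω => by
    simp only [Pi.pow_apply]; ring
  have hi1 : Integrable R P := hLs.integrable (by norm_num)
  have hi2 : Integrable (R ^ 2) P := hLs.integrable_sq
  simp only [hexp]
  have hi3 : Integrable (fun ω => r ^ 2 - 2 * r * R ω) P :=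
    (integrable_const _).sub (hi1.const_mul _)
  refine ⟨hi3.add hi2, ?_⟩
  rw [integral_add hi3 hi2, integral_sub (integrable_const _) (hi1.const_mul _),
    integral_const_mul, hM]
  simp only [integral_const, probReal_univ, one_smul, mul_zero, sub_zero]
  linarith

/-- A filter with the risk bound `E |x_t - [φ * y]_t|² ≤ ϱ σ² / (m+1)` on `[-m, n]` makes the
signal simple. -/
theorem IsSimple.of_risk {Ω : Type*} [MeasurableSpace Ω] {P : Measure Ω} [IsProbabilityMeasure P]
    {ζ : ℤ → Ω → ℂ} (hζ : IsStdComplexNoise ζ P) {m n : ℕ} {ϱ σ : ℝ} (hσ : 0 < σ)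
    {x φ : ℤ → ℂ} (hφ : φ ∈ supportedOn 0 m)
    (hrisk : ∀ t : ℤ, -(m : ℤ) ≤ t → t ≤ n →
      ∫ ω, ‖x t - conv φ (observe σ x (fun t => ζ t ω)) t‖ ^ 2 ∂P ≤ ϱ * σ ^ 2 / (m + 1)) :
    IsSimple m n ϱ σ x := by
  have hlaw : ∀ p : ℤ × Bool, HasLaw
      (fun ω => if p.2 then (ζ p.1 ω).re else (ζ p.1 ω).im) (gaussianReal 0 1) P := by
    rintro ⟨t, b⟩
    cases b
    · simpa using hζ.law_im t
    · simpa using hζ.law_re t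
  have key : ∀ t : ℤ, ∫ ω, ‖x t - conv φ (observe σ x (fun t => ζ t ω)) t‖ ^ 2 ∂P =
      ‖x t - conv φ x t‖ ^ 2 + 2 * σ ^ 2 * normTwo m φ ^ 2 := by
    intro t
    obtain ⟨i1, e1⟩ := integral_sq_sub_sum hlaw hζ.indep
      (Finset.Icc (t - m) t ×ˢ (Finset.univ : Finset Bool))
      (fun p => if p.2 then σ * (φ (t - p.1)).re else -(σ * (φ (t - p.1)).im))
      (x t - conv φ x t).re
    obtain ⟨i2, e2⟩ := integral_sq_sub_sum hlaw hζ.indep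
      (Finset.Icc (t - m) t ×ˢ (Finset.univ : Finset Bool))
      (fun p => if p.2 then σ * (φ (t - p.1)).im else σ * (φ (t - p.1)).re)
      (x t - conv φ x t).im
    have hpt : ∀ ω, ‖x t - conv φ (observe σ x (fun t => ζ t ω)) t‖ ^ 2 = _ + _ := fun ω => by
      have hc : x t - conv φ (observe σ x (fun t => ζ t ω)) t =
          (x t - conv φ x t) - ∑ u ∈ Finset.Icc (t - m) t, (σ : ℂ) * (φ (t - u) * ζ u ω) := by
        rw [conv_eq_sum hφ, conv_eq_sum hφ, sub_sub, ← Finset.sum_add_distrib]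
        congr 1
        refine Finset.sum_congr rfl fun u _ => ?_
        simp only [observe]
        ring
      rw [hc, Complex.sq_norm, Complex.normSq_apply, ← sq, ← sq, Complex.sub_re, Complex.sub_im,
        Complex.re_sum, Complex.im_sum]
    simp only [Finset.sum_product, Fintype.sum_bool, if_true, Bool.false_eq_true, if_false]
      at i1 e1 i2 e2
    have h1 : ∀ ω, ∑ u ∈ Finset.Icc (t - m) t, ((σ : ℂ) * (φ (t - u) * ζ u ω)).re =
        ∑ u ∈ Finset.Icc (t - m) t, (σ * (φ (t - u)).re * (ζ u ω).re +
          -(σ * (φ (t - u)).im) * (ζ u ω).im) := fun ω =>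
      Finset.sum_congr rfl fun u _ => by
        rw [Complex.re_ofReal_mul, Complex.mul_re]; ring
    have h2 : ∀ ω, ∑ u ∈ Finset.Icc (t - m) t, ((σ : ℂ) * (φ (t - u) * ζ u ω)).im =
        ∑ u ∈ Finset.Icc (t - m) t, (σ * (φ (t - u)).im * (ζ u ω).re +
          σ * (φ (t - u)).re * (ζ u ω).im) := fun ω =>
      Finset.sum_congr rfl fun u _ => by
        rw [Complex.im_ofReal_mul, Complex.mul_im]; ring
    simp only [hpt, h1, h2]
    rw [integral_add i1 i2, e1, e2, normTwo_sq_eq m φ t, Complex.sq_norm, Complex.normSq_apply,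
      Finset.mul_sum]
    have h3 : ∀ u : ℤ, ‖φ (t - u)‖ ^ 2 = (φ (t - u)).re ^ 2 + (φ (t - u)).im ^ 2 := fun u => by
      rw [Complex.sq_norm, Complex.normSq_apply]; ring
    simp only [h3]
    rw [add_add_add_comm, ← Finset.sum_add_distrib]
    congr 1
    · ring
    · exact Finset.sum_congr rfl fun u _ => by ring
  have hm : (0 : ℝ) < (m : ℝ) + 1 := by positivity
  refine ⟨φ, hφ, ?_, fun t h0 h1 => ?_⟩
  · have h := hrisk 0 (by omega) (by omega)
    rw [key, le_div_iff₀ hm] at h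
    rw [le_div_iff₀ hm]
    have h4 : 0 ≤ ‖x 0 - conv φ x 0‖ ^ 2 * ((m : ℝ) + 1) := by positivity
    have h5 : 0 ≤ normTwo m φ ^ 2 * ((m : ℝ) + 1) := by positivity
    have h6 : σ ^ 2 * (normTwo m φ ^ 2 * ((m : ℝ) + 1)) ≤ σ ^ 2 * ϱ := by
      nlinarith [mul_nonneg (sq_nonneg σ) h5]
    exact le_of_mul_le_mul_left h6 (by positivity)
  · have h := hrisk t h0 h1
    rw [key] at h
    have : 0 ≤ 2 * σ ^ 2 * normTwo m φ ^ 2 := by positivity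
    linarith

/-- `x` is the sum of an element of a shift-invariant subspace `S` of dimension `s` and of a
sequence `ε` with `‖Δ^τ ε‖_{n,2} ≤ ϰ σ` for `0 ≤ τ ≤ L`, where `L` is the filter bandwidth. -/
def NearShiftInvariant (L n s : ℕ) (ϰ σ : ℝ) (x : ℤ → ℂ) : Prop :=
  ∃ S : Submodule ℂ (ℤ → ℂ), S.map shift ≤ S ∧ FiniteDimensional ℂ S ∧ Module.finrank ℂ S = s ∧
    ∃ xS ∈ S, ∃ ε : ℤ → ℂ, x = xS + ε ∧
      ∀ τ : ℕ, τ ≤ L → normTwo n ((shift ^ τ) ε) ≤ ϰ * σ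

/-- The feasible set of the constrained least-squares problem of bandwidth `n`. -/
def feasible (n : ℕ) (ϱbar : ℝ) : Set (ℤ → ℂ) :=
  {φ | φ ∈ supportedOn 0 n ∧ specNormOne n φ ≤ ϱbar / Real.sqrt ((n : ℝ) + 1)}

/-- `φ` is an optimal solution of the constrained least-squares problem: minimize
`‖y - φ * y‖²_{n,2}` over the filters `φ` supported on `[0, n]` with
`‖φ‖*_{n,1} ≤ ϱbar / √(n+1)`. Only `y_{-n}, …, y_n` enter. -/
def IsConstrainedLS (n : ℕ) (ϱbar : ℝ) (y φ : ℤ → ℂ) : Prop :=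
  φ ∈ feasible n ϱbar ∧
    IsMinOn (fun ψ : ℤ → ℂ => normTwo n (y - conv ψ y) ^ 2) (feasible n ϱbar) φ

/-- The remainder
`ϱ κ² ln ((L + n) / α) + ϱ ϰ √(1 + ln (1 / α)) + s`, `κ² = (n + 1) / (L + 1)`,
for filters of bandwidth `L` and a validation window of length `n`. -/
def remainder (L n s : ℕ) (ϱ ϰ α : ℝ) : ℝ :=
  ϱ * (((n : ℝ) + 1) / (L + 1)) * Real.log (((L : ℝ) + n) / α)
    + ϱ * ϰ * Real.sqrt (1 + Real.log (1 / α)) + s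

end LocalFilter

end

/-! Write `h = x - ϕ * x`, with `ϕ` the filter from `IsSimple`. The oracle is `ϕ * ϕ`. Since `n =
2m`, the transform of length `n + 1` sees no wrap-around, so the spectral `ℓ₁`-norm of `ϕ * ϕ` is
`√(n+1) ‖ϕ‖₂²` (`specNormOne_conv_self`). This makes the oracle feasible, and its bias is `h + ϕ *
h`.

Comparing the least-squares value with that of the oracle bounds the squared residual norm of the
estimator by oracle terms plus the correlation of the noise with the estimator's own residual. That
correlation is split along `K`, the restriction of the shift-invariant subspace to `[0, n]`. The
projection of the noise on `K` has squared norm of order `s` plus a confidence level, and its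
contribution is absorbed. The complement of `K` annihilates the shift-invariant part of the
residual. What remains is linear in the random filter, hence controlled uniformly: the `ε` part by
Cauchy-Schwarz over the shifts, the noise part by expanding the filter in Fourier filters, where
only `n + 1` fixed quadratic forms matter, at a logarithmic price (`inner_residual_le`,
`normTwo_risk_le`).

To pass to a single point, apply `1 = ϕ + (1 - ϕ)` to the residual `x - φ * y`. The first part
averages the residual over `[t - m, t] ⊆ [0, n]` with a filter of small `ℓ₂`-norm. The second equals
`h - φ * h - σ φ * z + σ φ * ϕ * z`, each term of which is bounded directly (`pointwise_risk_le`).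

All randomness sits in `NoiseBound`, a finite list of conditions on linear and quadratic forms of a
Gaussian vector in which the estimator does not occur; one event therefore serves every optimal
solution. Its probability comes from tails of Gaussian quadratic forms and a union bound.
Integrating the tail in `α` gives the bound in expectation. -/

noncomputable section

namespace LocalFilter

/-! ### Exponential tails of real Gaussian quadratic forms. -/

section GaussianChaos

/-- The left side is the moment generating function of `ξ²` at `c` for `ξ` standard normal. The
bound follows from `log (1 - x) ≥ -x - 2x²` for `|x| ≤ 1/2`, taken at `x = 2c`. -/
theorem inv_sqrt_one_sub_two_mul_le {c : ℝ} (hc : |c| ≤ 1 / 4) :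
    (√(1 - 2 * c))⁻¹ ≤ Real.exp (c + 4 * c ^ 2) := by
  obtain ⟨h1, h2⟩ := abs_le.1 hc
  have hpos : 0 < 1 - 2 * c := by linarith
  have habs : |2 * c| ≤ 1 / 2 := by rw [abs_mul, abs_two]; linarith
  have hlog := Real.abs_log_sub_add_sum_range_le (x := 2 * c) (by linarith) 1
  have hdiv : |2 * c| ^ (1 + 1) / (1 - |2 * c|) ≤ 2 * (2 * c) ^ 2 := by
    rw [div_le_iff₀ (by linarith), one_add_one_eq_two, sq_abs]
    nlinarith [sq_nonneg (2 * c)]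
  have hlog' : -(2 * (c + 4 * c ^ 2)) ≤ Real.log (1 - 2 * c) := by
    have := (abs_le.1 (hlog.trans hdiv)).1
    simp at this
    linarith
  have key : Real.exp (-(2 * (c + 4 * c ^ 2))) ≤ 1 - 2 * c := (Real.le_log_iff_exp_le hpos).1 hlog'
  have h6 : Real.exp (-(c + 4 * c ^ 2)) ≤ √(1 - 2 * c) := by
    apply Real.le_sqrt_of_sq_le
    rw [← Real.exp_nat_mul]
    convert key using 2
    push_cast; ring
  rw [show Real.exp (c + 4 * c ^ 2) = (Real.exp (-(c + 4 * c ^ 2)))⁻¹ by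
    rw [Real.exp_neg, inv_inv]]
  exact inv_anti₀ (Real.exp_pos _) h6

theorem integrable_exp_mul_sq_gaussianReal {c : ℝ} (hc : |c| ≤ 1 / 4) :
    Integrable (fun x : ℝ => Real.exp (c * x ^ 2)) (gaussianReal 0 1) := by
  obtain ⟨h1, h2⟩ := abs_le.1 hc
  rw [gaussianReal_of_var_ne_zero _ one_ne_zero,
    integrable_withDensity_iff_integrable_smul₀' (by fun_prop) (by simp [gaussianPDF])]
  have h := (integrable_exp_neg_mul_sq (b := 1 / 2 - c) (by linarith)).const_mul ((√(2 * Real.pi))⁻¹)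
  refine h.congr (ae_of_all _ fun x => ?_)
  simp only [gaussianPDF, gaussianPDFReal, smul_eq_mul]
  rw [ENNReal.toReal_ofReal (by positivity), mul_assoc]
  simp only [NNReal.coe_one, mul_one, sub_zero]
  rw [← Real.exp_add]
  ring_nf

theorem integral_exp_mul_sq_gaussianReal_le {c : ℝ} (hc : |c| ≤ 1 / 4) :
    ∫ x : ℝ, Real.exp (c * x ^ 2) ∂(gaussianReal 0 1) ≤ Real.exp (c + 4 * c ^ 2) := by
  obtain ⟨h1, h2⟩ := abs_le.1 hc
  refine le_of_eq_of_le ?_ (inv_sqrt_one_sub_two_mul_le hc)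
  rw [integral_gaussianReal_eq_integral_smul one_ne_zero]
  have : ∀ x : ℝ, gaussianPDFReal 0 1 x • Real.exp (c * x ^ 2)
      = (√(2 * Real.pi))⁻¹ * Real.exp (-(1 / 2 - c) * x ^ 2) := fun x => by
    simp only [gaussianPDFReal, smul_eq_mul, NNReal.coe_one, mul_one, sub_zero]
    rw [mul_assoc, ← Real.exp_add]
    ring_nf
  simp only [this]
  rw [integral_const_mul, integral_gaussian, ← Real.sqrt_inv, ← Real.sqrt_inv,
    ← Real.sqrt_mul (by positivity)]
  congr 1
  have : 1 - 2 * c ≠ 0 := by linarith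
  have : (1 / 2 - c) ≠ 0 := by linarith
  field_simp

variable {E : Type*} [NormedAddCommGroup E] [InnerProductSpace ℝ E] [FiniteDimensional ℝ E]

open scoped RealInnerProductSpace

theorem sum_sq_norm_map_eq {β β' : Type*} [Fintype β] [Fintype β'] (b : OrthonormalBasis β ℝ E)
    (b' : OrthonormalBasis β' ℝ E) (T : E →ₗ[ℝ] E) :
    ∑ i, ‖T (b i)‖ ^ 2 = ∑ i, ‖T.adjoint (b' i)‖ ^ 2 := by
  have h1 : ∀ i, ‖T (b i)‖ ^ 2 = ∑ j, ⟪b' j, T (b i)⟫ ^ 2 := fun i =>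
    (b'.sum_sq_inner_right _).symm
  have h2 : ∀ j, ‖T.adjoint (b' j)‖ ^ 2 = ∑ i, ⟪b i, T.adjoint (b' j)⟫ ^ 2 := fun i =>
    (b.sum_sq_inner_right _).symm
  simp only [h1, h2]
  rw [Finset.sum_comm]
  refine Finset.sum_congr rfl fun j _ => Finset.sum_congr rfl fun i _ => ?_
  rw [LinearMap.adjoint_inner_right, real_inner_comm]

variable [MeasurableSpace E] [BorelSpace E]

/-- In an eigenbasis the Gaussian coordinates remain independent and the form becomes `∑ d_i ξ_i²`,
so the moment generating function factors. The sums of `d_i` and `d_i²` are the trace and the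
squared Hilbert-Schmidt norm, computable in any orthonormal basis. -/
theorem mgf_inner_symmetric_le {T : E →ₗ[ℝ] E} (hT : T.IsSymmetric) {β : Type*} [Fintype β]
    (b : OrthonormalBasis β ℝ E) {l B : ℝ} (hl : 0 ≤ l) (hB : ∀ v, |⟪v, T v⟫| ≤ B * ‖v‖ ^ 2)
    (hlB : l * B ≤ 1 / 4) :
    Integrable (fun v => Real.exp (l * ⟪v, T v⟫)) (stdGaussian E) ∧
    mgf (fun v => ⟪v, T v⟫) (stdGaussian E) l ≤
      Real.exp (l * ∑ i, ⟪b i, T (b i)⟫ + 4 * l ^ 2 * ∑ i, ‖T (b i)‖ ^ 2) := by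
  set e := hT.eigenvectorBasis rfl with he
  set d := hT.eigenvalues rfl with hd
  have hTe : ∀ i, T (e i) = d i • e i := fun i => 
    hT.apply_eigenvectorBasis rfl i
  have hdB : ∀ i, |l * d i| ≤ 1 / 4 := fun i => by
    have h := hB (e i)
    rw [hTe, inner_smul_right, real_inner_self_eq_norm_sq, e.norm_eq_one] at h
    rw [abs_mul, abs_of_nonneg hl]
    calc l * |d i| ≤ l * B := mul_le_mul_of_nonneg_left (by simpa using h) hl
      _ ≤ _ := hlB
  have hq : ∀ x : Fin (Module.finrank ℝ E) → ℝ,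
      ⟪∑ i, x i • e i, T (∑ i, x i • e i)⟫ = ∑ i, d i * x i ^ 2 := fun x => by
    have : T (∑ i, x i • e i) = ∑ i, (x i * d i) • e i := by
      simp [map_sum, hTe, smul_smul]
    rw [this, e.orthonormal.inner_sum]
    refine Finset.sum_congr rfl fun i _ => ?_
    simp; ring
  have hprod : ∀ x : Fin (Module.finrank ℝ E) → ℝ,
      Real.exp (l * ⟪∑ i, x i • e i, T (∑ i, x i • e i)⟫) = ∏ i, Real.exp (l * d i * x i ^ 2) :=
    fun x => by
      rw [hq, ← Real.exp_sum, Finset.mul_sum]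
      simp only [mul_assoc]
  have hTc : Continuous T := T.continuous_of_finiteDimensional
  have hmeas : AEMeasurable (fun x : Fin (Module.finrank ℝ E) → ℝ => ∑ i, x i • e i)
      (Measure.pi fun _ => gaussianReal 0 1) :=
    (show Measurable _ by fun_prop).aemeasurable
  have hcont : Continuous (fun v : E => Real.exp (l * ⟪v, T v⟫)) := by fun_prop
  have hint : Integrable (fun x : Fin (Module.finrank ℝ E) → ℝ => ∏ i, Real.exp (l * d i * x i ^ 2))
      (Measure.pi fun _ => gaussianReal 0 1) :=
    Integrable.fintype_prod (f := fun i x => Real.exp (l * d i * x ^ 2))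
      fun i => integrable_exp_mul_sq_gaussianReal (hdB i)
  rw [stdGaussian_eq_map_pi_orthonormalBasis e]
  constructor
  · rw [integrable_map_measure (hcont.aestronglyMeasurable) hmeas]
    exact hint.congr (ae_of_all _ fun x => (hprod x).symm)
  · rw [mgf, integral_map hmeas hcont.aestronglyMeasurable]
    simp only [hprod]
    rw [integral_fintype_prod_eq_prod (f := fun i x => Real.exp (l * d i * x ^ 2))]
    have htr : ∑ i, ⟪b i, T (b i)⟫ = ∑ i, d i := by
      rw [← T.trace_eq_sum_inner b, T.trace_eq_sum_inner e]
      refine Finset.sum_congr rfl fun i _ => ?_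
      rw [hTe, inner_smul_right, real_inner_self_eq_norm_sq, e.norm_eq_one]
      simp
    have hF : ∑ i, ‖T (b i)‖ ^ 2 = ∑ i, d i ^ 2 := by
      rw [sum_sq_norm_map_eq b e, hT.adjoint_eq]
      refine Finset.sum_congr rfl fun i _ => ?_
      rw [hTe, norm_smul, e.norm_eq_one]
      simp
    rw [htr, hF, Finset.mul_sum, Finset.mul_sum, ← Finset.sum_add_distrib, Real.exp_sum]
    refine Finset.prod_le_prod (fun i _ => integral_nonneg fun x => (Real.exp_pos _).le)
      fun i _ => ?_
    refine (integral_exp_mul_sq_gaussianReal_le (hdB i)).trans (le_of_eq ?_)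
    ring_nf

/-- Symmetrizing `T` preserves the quadratic form and does not increase the Hilbert-Schmidt norm;
then Chernoff applies. The parameter `l` stays free because projections call for a different choice
than general operators. -/
theorem inner_map_tail (T : E →ₗ[ℝ] E) {β : Type*} [Fintype β]
    (b : OrthonormalBasis β ℝ E) {l B F u : ℝ} (hl : 0 < l)
    (hB : ∀ v, |⟪v, T v⟫| ≤ B * ‖v‖ ^ 2) (hlB : l * B ≤ 1 / 4)
    (hF : ∑ i, ‖T (b i)‖ ^ 2 ≤ F) :
    (stdGaussian E).real {v | ∑ i, ⟪b i, T (b i)⟫ + 4 * l * F + u / l < ⟪v, T v⟫} ≤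
      Real.exp (-u) := by
  set S : E →ₗ[ℝ] E := (1 / 2 : ℝ) • (T + T.adjoint) with hS
  have hSv : ∀ v, ⟪v, S v⟫ = ⟪v, T v⟫ := fun v => by
    simp only [hS, LinearMap.smul_apply, LinearMap.add_apply, inner_smul_right, inner_add_right,
      LinearMap.adjoint_inner_right]
    rw [real_inner_comm v (T v)]
    ring
  have hSs : S.IsSymmetric := fun v w => by
    simp only [hS, LinearMap.smul_apply, LinearMap.add_apply, inner_smul_right, inner_add_right,
      real_inner_smul_left, inner_add_left, LinearMap.adjoint_inner_right,
      LinearMap.adjoint_inner_left]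
    ring
  have hSF : ∑ i, ‖S (b i)‖ ^ 2 ≤ F := by
    have h1 : ∀ i, ‖S (b i)‖ ^ 2 ≤ (1 / 2) * (‖T (b i)‖ ^ 2 + ‖T.adjoint (b i)‖ ^ 2) := fun i => by
      have h2 : ‖S (b i)‖ ≤ (1 / 2) * (‖T (b i)‖ + ‖T.adjoint (b i)‖) := by
        simp only [hS, LinearMap.smul_apply, LinearMap.add_apply, norm_smul]
        rw [Real.norm_of_nonneg (by norm_num)]
        gcongr
        exact norm_add_le _ _
      have h3 := pow_le_pow_left₀ (norm_nonneg _) h2 2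
      nlinarith [sq_nonneg (‖T (b i)‖ - ‖T.adjoint (b i)‖)]
    refine (Finset.sum_le_sum fun i _ => h1 i).trans ?_
    rw [← Finset.mul_sum, Finset.sum_add_distrib, ← sum_sq_norm_map_eq b b T]
    linarith
  obtain ⟨hi, hm⟩ := mgf_inner_symmetric_le hSs b hl.le (by simpa only [hSv] using hB) hlB
  simp only [hSv] at hi hm
  refine (measureReal_mono (fun v hv => ?_)).trans ((measure_ge_le_exp_mul_mgf
    (∑ i, ⟪b i, T (b i)⟫ + 4 * l * F + u / l) hl.le hi).trans ?_)
  · exact le_of_lt (α := ℝ) hv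
  · refine (mul_le_mul_of_nonneg_left hm (Real.exp_pos _).le).trans ?_
    rw [← Real.exp_add, Real.exp_le_exp]
    have : 4 * l ^ 2 * ∑ i, ‖S (b i)‖ ^ 2 ≤ 4 * l ^ 2 * F := by gcongr
    have h5 : l * (u / l) = u := by field_simp
    nlinarith

end GaussianChaos

/-! ### Quadratic forms of complex Gaussian vectors. -/

section ComplexChaos

open scoped ComplexInnerProductSpace

variable {ι : Type*} [Fintype ι]

theorem real_inner_eq_re (v w : EuclideanSpace ℂ ι) : inner ℝ v w = (⟪v, w⟫).re := by
  simp [PiLp.inner_apply, Complex.re_sum]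

variable [DecidableEq ι]

/-- The standard orthonormal basis vectors. -/
abbrev stdBasis (i : ι) : EuclideanSpace ℂ ι := EuclideanSpace.single i 1

/-- The basis `δ_i, I • δ_i` of `ℂ^ι` as a real inner product space. -/
def realBasis (ι : Type*) [Fintype ι] :
    OrthonormalBasis ((_ : ι) × Fin 2) ℝ (EuclideanSpace ℂ ι) :=
  Pi.orthonormalBasis fun _ => Complex.orthonormalBasisOneI

theorem realBasis_zero (i : ι) : realBasis ι ⟨i, 0⟩ = stdBasis i := by
  simp [realBasis, Pi.orthonormalBasis_apply, stdBasis]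

theorem realBasis_one (i : ι) : realBasis ι ⟨i, 1⟩ = Complex.I • stdBasis i := by
  ext j
  by_cases h : j = i <;>
    simp [realBasis, Pi.orthonormalBasis_apply, stdBasis, h]

theorem sum_realBasis (f : EuclideanSpace ℂ ι → ℝ) :
    ∑ i, f (realBasis ι i) = ∑ i, (f (stdBasis i) + f (Complex.I • stdBasis i)) := by
  rw [Fintype.sum_sigma]
  refine Finset.sum_congr rfl fun i _ => ?_
  rw [Fin.sum_univ_two, realBasis_zero, realBasis_one]

/-- Over the reals each coordinate contributes the two basis vectors `δ_i` and `I δ_i`, with equal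
shares in the trace and in the Hilbert-Schmidt norm. This doubles both quantities in the real bound.
-/
theorem re_inner_map_tail (T : EuclideanSpace ℂ ι →ₗ[ℂ] EuclideanSpace ℂ ι) {l B F u : ℝ}
    (hl : 0 < l) (hB : ∀ v, ‖⟪v, T v⟫‖ ≤ B * ‖v‖ ^ 2) (hlB : l * B ≤ 1 / 4)
    (hF : ∑ i, ‖T (stdBasis i)‖ ^ 2 ≤ F) :
    (stdGaussian (EuclideanSpace ℂ ι)).real
      {v | 2 * (∑ i, ⟪stdBasis i, T (stdBasis i)⟫).re + 8 * l * F + u / l < (⟪v, T v⟫).re} ≤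
      Real.exp (-u) := by
  have h := inner_map_tail (T.restrictScalars ℝ) (realBasis ι) (B := B) (F := 2 * F) (u := u) hl
    (fun v => by
      rw [LinearMap.coe_restrictScalars, real_inner_eq_re]
      exact (Complex.abs_re_le_norm _).trans (hB v)) hlB
    (by
      rw [sum_realBasis fun v => ‖(T.restrictScalars ℝ) v‖ ^ 2, Finset.sum_add_distrib]
      simp only [LinearMap.coe_restrictScalars, map_smul, norm_smul, Complex.norm_I, one_mul]
      linarith)
  rw [sum_realBasis fun v => inner ℝ v ((T.restrictScalars ℝ) v)] at h
  have h1 : ∑ i, (inner ℝ (stdBasis i) ((T.restrictScalars ℝ) (stdBasis i)) +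
      inner ℝ (Complex.I • stdBasis i) ((T.restrictScalars ℝ) (Complex.I • stdBasis i))) =
      2 * (∑ i, ⟪stdBasis i, T (stdBasis i)⟫).re := by
    rw [Complex.re_sum, Finset.mul_sum]
    refine Finset.sum_congr rfl fun i _ => ?_
    rw [LinearMap.coe_restrictScalars, real_inner_eq_re, real_inner_eq_re, map_smul,
      inner_smul_left, inner_smul_right, ← mul_assoc]
    simp
    ring
  rw [h1, show 4 * l * (2 * F) = 8 * l * F by ring] at h
  simpa only [real_inner_eq_re, LinearMap.coe_restrictScalars] using h

theorem norm_map_le_of_sum_sq_le {W : Type*} [NormedAddCommGroup W] [InnerProductSpace ℂ W]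
    (T : EuclideanSpace ℂ ι →ₗ[ℂ] W) {F : ℝ} (hF0 : 0 ≤ F)
    (hF : ∑ i, ‖T (stdBasis i)‖ ^ 2 ≤ F ^ 2) (v : EuclideanSpace ℂ ι) : ‖T v‖ ≤ F * ‖v‖ := by
  have hv : T v = ∑ i, v i • T (stdBasis i) := by
    conv_lhs => rw [← (EuclideanSpace.basisFun ι ℂ).sum_repr v]
    simp [stdBasis]
  have h1 : ‖T v‖ ≤ ∑ i, ‖v i‖ * ‖T (stdBasis i)‖ := by
    rw [hv]
    refine (norm_sum_le _ _).trans (le_of_eq ?_)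
    simp only [norm_smul]
  have h2 := Finset.sum_mul_sq_le_sq_mul_sq Finset.univ (fun i => ‖v i‖) fun i => ‖T (stdBasis i)‖
  rw [← EuclideanSpace.norm_sq_eq] at h2
  refine h1.trans (abs_le_of_sq_le_sq' ?_ (by positivity)).2
  calc _ ≤ _ := h2
    _ ≤ ‖v‖ ^ 2 * F ^ 2 := by gcongr
    _ = _ := by ring

theorem norm_inner_map_le_of_sum_sq_le (T : EuclideanSpace ℂ ι →ₗ[ℂ] EuclideanSpace ℂ ι) {F : ℝ}
    (hF0 : 0 ≤ F) (hF : ∑ i, ‖T (stdBasis i)‖ ^ 2 ≤ F ^ 2) (v : EuclideanSpace ℂ ι) :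
    ‖⟪v, T v⟫‖ ≤ F * ‖v‖ ^ 2 := by
  refine (norm_inner_le_norm _ _).trans ?_
  have := norm_map_le_of_sum_sq_le T hF0 hF v
  nlinarith [norm_nonneg v]

/-- The Hilbert-Schmidt bound `F` also dominates the operator norm, so `l = 1 / (4F)` is admissible;
`F = 0` forces the form to vanish. The unimodular factor `c` gives access to every direction of the
complex value. -/
theorem re_smul_inner_map_tail (T : EuclideanSpace ℂ ι →ₗ[ℂ] EuclideanSpace ℂ ι) {F u τ : ℝ}
    (hF0 : 0 ≤ F) (hF : ∑ i, ‖T (stdBasis i)‖ ^ 2 ≤ F ^ 2) (hτ0 : 0 ≤ τ)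
    (hτ : ‖∑ i, ⟪stdBasis i, T (stdBasis i)⟫‖ ≤ τ) {c : ℂ} (hc : ‖c‖ = 1) :
    (stdGaussian (EuclideanSpace ℂ ι)).real
      {v | 2 * τ + 2 * F + 4 * F * u < (c * ⟪v, T v⟫).re} ≤ Real.exp (-u) := by
  rcases hF0.eq_or_lt with rfl | hFpos
  · have hzero : ∀ v, ⟪v, T v⟫ = 0 := fun v => by
      have := norm_inner_map_le_of_sum_sq_le T le_rfl hF v
      rw [zero_mul] at this
      exact norm_le_zero_iff.1 this
    have : {v : EuclideanSpace ℂ ι | 2 * τ + 2 * 0 + 4 * 0 * u < (c * ⟪v, T v⟫).re} = ∅ := by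
      ext v
      simp [hzero, hτ0]
    rw [this]
    simpa using (Real.exp_pos _).le
  · have h := re_inner_map_tail (c • T) (l := 1 / (4 * F)) (B := F) (F := F ^ 2) (u := u)
      (by positivity)
      (norm_inner_map_le_of_sum_sq_le (c • T) hF0 (by simpa [norm_smul, hc] using hF))
      (by field_simp; norm_num) (by simpa [norm_smul, hc] using hF)
    refine (measureReal_mono fun v hv => ?_).trans h
    simp only [Set.mem_ofPred_eq, LinearMap.smul_apply, inner_smul_right, ← Finset.mul_sum] at hv ⊢
    refine lt_of_le_of_lt ?_ hv
    have h1 : (c * ∑ i, ⟪stdBasis i, T (stdBasis i)⟫).re ≤ τ := by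
      refine (Complex.re_le_norm _).trans ?_
      rwa [norm_mul, hc, one_mul]
    have h2 : 8 * (1 / (4 * F)) * F ^ 2 = 2 * F := by field_simp; norm_num
    have h3 : u / (1 / (4 * F)) = 4 * F * u := by field_simp
    rw [h2, h3]
    linarith

/-- Exponential tail of a quadratic form of a standard complex Gaussian vector. -/
theorem norm_inner_map_tail (T : EuclideanSpace ℂ ι →ₗ[ℂ] EuclideanSpace ℂ ι) {F u τ : ℝ}
    (hF0 : 0 ≤ F) (hF : ∑ i, ‖T (stdBasis i)‖ ^ 2 ≤ F ^ 2) (hτ0 : 0 ≤ τ)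
    (hτ : ‖∑ i, ⟪stdBasis i, T (stdBasis i)⟫‖ ≤ τ) :
    (stdGaussian (EuclideanSpace ℂ ι)).real
      {v | 4 * τ + 8 * F * (1 + u) < ‖⟪v, T v⟫‖} ≤ 4 * Real.exp (-u) := by
  -- The four rotations `±1`, `±I` bound the absolute values of the real and imaginary parts, and
  -- hence the modulus.
  have key := fun c hc => re_smul_inner_map_tail T (u := u) hF0 hF hτ0 hτ (c := c) hc
  have k1 := key 1 (by simp)
  have k2 := key (-1) (by simp)
  have k3 := key Complex.I (by simp)
  have k4 := key (-Complex.I) (by simp)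
  have hsub : {v | 4 * τ + 8 * F * (1 + u) < ‖⟪v, T v⟫‖} ⊆
      ({v | 2 * τ + 2 * F + 4 * F * u < (1 * ⟪v, T v⟫).re} ∪
      {v | 2 * τ + 2 * F + 4 * F * u < (-1 * ⟪v, T v⟫).re}) ∪
      ({v | 2 * τ + 2 * F + 4 * F * u < (Complex.I * ⟪v, T v⟫).re} ∪
      {v | 2 * τ + 2 * F + 4 * F * u < (-Complex.I * ⟪v, T v⟫).re}) := fun v hv => by
    simp only [Set.mem_union, Set.mem_ofPred_eq] at hv ⊢
    by_contra hcon
    push Not at hcon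
    obtain ⟨⟨h1, h2⟩, h3, h4⟩ := hcon
    simp at h1 h2 h3 h4
    have h5 : |(⟪v, T v⟫).re| ≤ 2 * τ + 2 * F + 4 * F * u := abs_le.2 ⟨by linarith, h1⟩
    have h6 : |(⟪v, T v⟫).im| ≤ 2 * τ + 2 * F + 4 * F * u := abs_le.2 ⟨by linarith, by linarith⟩
    have := Complex.norm_le_abs_re_add_abs_im ⟪v, T v⟫
    linarith
  refine (measureReal_mono hsub).trans ((measureReal_union_le _ _).trans ?_)
  have h1 := measureReal_union_le (μ := stdGaussian (EuclideanSpace ℂ ι))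
    {v | 2 * τ + 2 * F + 4 * F * u < (1 * ⟪v, T v⟫).re}
    {v | 2 * τ + 2 * F + 4 * F * u < (-1 * ⟪v, T v⟫).re}
  have h2 := measureReal_union_le (μ := stdGaussian (EuclideanSpace ℂ ι))
    {v | 2 * τ + 2 * F + 4 * F * u < (Complex.I * ⟪v, T v⟫).re}
    {v | 2 * τ + 2 * F + 4 * F * u < (-Complex.I * ⟪v, T v⟫).re}
  linarith

/-- Exponential tail of the squared norm of a linear image of a standard complex Gaussian
vector. -/
theorem sum_sq_inner_tail {κ : Type*} (s : Finset κ) (w : κ → EuclideanSpace ℂ ι) {V u : ℝ}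
    (hV : ∑ k ∈ s, ‖w k‖ ^ 2 ≤ V) :
    (stdGaussian (EuclideanSpace ℂ ι)).real
      {v | 4 * V * (1 + u) < ∑ k ∈ s, ‖⟪w k, v⟫‖ ^ 2} ≤ Real.exp (-u) := by
  -- The sum of squares is the form of the positive operator `∑ |w_k⟩⟨w_k|`, whose trace is `∑
  -- ‖w_k‖² ≤ V`; its Hilbert-Schmidt norm is then at most `V` as well.
  set T : EuclideanSpace ℂ ι →ₗ[ℂ] EuclideanSpace ℂ ι :=
    ∑ k ∈ s, (innerSL ℂ (w k)).toLinearMap.smulRight (w k) with hT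
  have hTv : ∀ v, T v = ∑ k ∈ s, ⟪w k, v⟫ • w k := fun v => by
    simp [hT, LinearMap.sum_apply]
  have hq : ∀ v, ⟪v, T v⟫ = ((∑ k ∈ s, ‖⟪w k, v⟫‖ ^ 2 : ℝ) : ℂ) := fun v => by
    rw [hTv, inner_sum, Complex.ofReal_sum]
    refine Finset.sum_congr rfl fun k _ => ?_
    rw [inner_smul_right, ← inner_conj_symm v (w k), Complex.mul_conj, Complex.normSq_eq_norm_sq]
  have hV0 : 0 ≤ V := (Finset.sum_nonneg fun _ _ => by positivity).trans hV
  have hsw : ∀ k i, ‖⟪w k, stdBasis i⟫‖ = ‖w k i‖ := fun k i => by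
    simp [stdBasis, EuclideanSpace.inner_single_right]
  have htr : ‖∑ i, ⟪stdBasis i, T (stdBasis i)⟫‖ ≤ V := by
    refine le_trans (le_of_eq ?_) hV
    simp only [hq, ← Complex.ofReal_sum]
    rw [Complex.norm_real, Real.norm_of_nonneg (by positivity), Finset.sum_comm]
    refine Finset.sum_congr rfl fun k _ => ?_
    simp only [hsw, EuclideanSpace.norm_sq_eq]
  have hF : ∑ i, ‖T (stdBasis i)‖ ^ 2 ≤ V ^ 2 := by
    have h1 : ∀ i, ‖T (stdBasis i)‖ ^ 2 ≤ (∑ k ∈ s, ‖w k i‖ ^ 2) * V := fun i => by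
      have h2 : ‖T (stdBasis i)‖ ≤ ∑ k ∈ s, ‖w k i‖ * ‖w k‖ := by
        rw [hTv]
        refine (norm_sum_le _ _).trans (le_of_eq ?_)
        simp only [norm_smul, hsw]
      refine (pow_le_pow_left₀ (norm_nonneg _) h2 2).trans
        ((Finset.sum_mul_sq_le_sq_mul_sq s _ _).trans ?_)
      gcongr
    refine (Finset.sum_le_sum fun i _ => h1 i).trans ?_
    rw [← Finset.sum_mul, Finset.sum_comm, sq]
    refine mul_le_mul_of_nonneg_right (le_trans (le_of_eq ?_) hV) hV0
    simp only [EuclideanSpace.norm_sq_eq]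
  have h := re_smul_inner_map_tail T (u := u) hV0 hF hV0 htr (c := 1) (by simp)
  refine (measureReal_mono fun v hv => ?_).trans h
  simp only [Set.mem_ofPred_eq, one_mul, hq, Complex.ofReal_re] at hv ⊢
  linarith

theorem sum_sq_norm_starProjection (K : Submodule ℂ (EuclideanSpace ℂ ι)) :
    ∑ i, ‖K.starProjection (stdBasis i)‖ ^ 2 = Module.finrank ℂ K := by
  set b := stdOrthonormalBasis ℂ K
  have h1 : ∀ i : ι, ‖K.starProjection (stdBasis i)‖ ^ 2 =
      ∑ j, ‖(b j : EuclideanSpace ℂ ι) i‖ ^ 2 := fun i => by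
    rw [Submodule.starProjection_apply, ← Submodule.coe_norm, ← b.sum_sq_norm_inner_right]
    refine Finset.sum_congr rfl fun j _ => ?_
    rw [Submodule.inner_orthogonalProjectionOnto_eq_of_mem_left]
    simp [stdBasis, EuclideanSpace.inner_single_right]
  simp only [h1]
  rw [Finset.sum_comm]
  simp only [← EuclideanSpace.norm_sq_eq, ← Submodule.coe_norm, b.norm_eq_one]
  simp

/-- Exponential tail of the squared norm of the orthogonal projection of a standard complex
Gaussian vector. -/
theorem starProjection_tail (K : Submodule ℂ (EuclideanSpace ℂ ι)) {s : ℕ}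
    (hs : Module.finrank ℂ K ≤ s) {u : ℝ} :
    (stdGaussian (EuclideanSpace ℂ ι)).real
      {v | 4 * (s + u) < ‖K.starProjection v‖ ^ 2} ≤ Real.exp (-u) := by
  have hq : ∀ v, ⟪v, K.starProjection v⟫ = ((‖K.starProjection v‖ ^ 2 : ℝ) : ℂ) := fun v => by
    have h1 : K.starProjection (K.starProjection v) = K.starProjection v :=
      Submodule.starProjection_eq_self_iff.2 (K.starProjection_apply_mem v)
    rw [← h1, ← Submodule.inner_starProjection_left_eq_right, h1, inner_self_eq_norm_sq_to_K]
    simp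
  -- A projection has operator norm at most `1`, so `l = 1/4` is allowed. This gives `2s + 2s + 4u`,
  -- additive in `s` and `u`, where `sum_sq_inner_tail` would produce the product `s * u`.
  have h := re_inner_map_tail K.starProjection.toLinearMap (l := 1 / 4) (B := 1)
    (F := Module.finrank ℂ K) (u := u) (by norm_num)
    (fun v => by
      rw [ContinuousLinearMap.coe_coe, hq, Complex.norm_real,
        Real.norm_of_nonneg (by positivity), one_mul]
      gcongr
      exact K.norm_starProjection_apply_le v) (by norm_num)
    (sum_sq_norm_starProjection K).le
  refine (measureReal_mono fun v hv => ?_).trans h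
  simp only [Set.mem_ofPred_eq, ContinuousLinearMap.coe_coe, hq, ← Complex.ofReal_sum,
    Complex.ofReal_re, sum_sq_norm_starProjection] at hv ⊢
  have : (Module.finrank ℂ K : ℝ) ≤ s := by exact_mod_cast hs
  linarith

end ComplexChaos

/-! ### Reduction to the finite window `[-n, n]`; convolution as a matrix. -/

section Window

open scoped ComplexInnerProductSpace

/-- The vectors indexed by the window `[-n, n]`. -/
abbrev Win (n : ℕ) : Type := EuclideanSpace ℂ (Finset.Icc (-(n : ℤ)) n)

/-- The restriction of a sequence to `[-n, n]`. -/
def win (n : ℕ) (z : ℤ → ℂ) : Win n := WithLp.toLp 2 fun i => z i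

@[simp]
theorem win_apply (n : ℕ) (z : ℤ → ℂ) (i : Finset.Icc (-(n : ℤ)) n) : win n z i = z i := rfl

theorem measurable_win (n : ℕ) : Measurable (win n) :=
  (WithLp.measurable_toLp 2 _).comp (measurable_pi_lambda _ fun i => measurable_pi_apply (i : ℤ))

/-- The coordinates of the restricted noise in `realBasis` are exactly the independent real and
imaginary parts, and a standard Gaussian is the image of a product of `N(0, 1)` laws under any
orthonormal basis. -/
theorem map_win_eq_stdGaussian {Ω : Type*} [MeasurableSpace Ω] {P : Measure Ω}
    [IsProbabilityMeasure P] {ζ : ℤ → Ω → ℂ} (hζ : IsStdComplexNoise ζ P) (n : ℕ) :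
    AEMeasurable (fun ω => win n fun t => ζ t ω) P ∧
      P.map (fun ω => win n fun t => ζ t ω) = stdGaussian (Win n) := by
  set κ := (_ : Finset.Icc (-(n : ℤ)) n) × Fin 2
  set g : κ → ℤ × Bool := fun p => (p.1, p.2 = 0) with hg
  have hginj : Function.Injective g := by
    rintro ⟨i, a⟩ ⟨j, b⟩ h
    simp only [hg, Prod.mk.injEq] at h
    obtain ⟨h1, h2⟩ := h
    have h3 : i = j := Subtype.ext h1
    subst h3
    fin_cases a <;> fin_cases b <;> simp_all
  set ξ : κ → Ω → ℝ := fun p ω => if (g p).2 then (ζ (g p).1 ω).re else (ζ (g p).1 ω).im with hξ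
  have hind : iIndepFun ξ P := hζ.indep.precomp hginj
  have hlaw : ∀ p, HasLaw (ξ p) (gaussianReal 0 1) P := fun p => by
    by_cases h : (g p).2
    · simpa [hξ, h] using hζ.law_re (g p).1
    · simpa [hξ, h] using hζ.law_im (g p).1
  have hmap := (iIndepFun_iff_map_fun_eq_pi_map fun p => (hlaw p).aemeasurable).1 hind
  simp only [(hlaw _).map_eq] at hmap
  have hsum : (fun ω => win n fun t => ζ t ω) =
      (fun x : κ → ℝ => ∑ p, x p • realBasis (Finset.Icc (-(n : ℤ)) n) p) ∘
        fun ω p => ξ p ω := by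
    ext ω i
    simp only [Function.comp_apply]
    rw [Fintype.sum_sigma]
    simp only [Fin.sum_univ_two, realBasis_zero, realBasis_one, hξ, hg]
    simp [stdBasis, Finset.sum_add_distrib, Pi.single_apply, Finset.sum_apply]
  have hae : AEMeasurable (fun ω p => ξ p ω) P :=
    aemeasurable_pi_lambda _ fun p => (hlaw p).aemeasurable
  have hms : Measurable (fun x : κ → ℝ => ∑ p, x p • realBasis (Finset.Icc (-(n : ℤ)) n) p) := by
    fun_prop
  refine ⟨hsum ▸ hms.comp_aemeasurable hae, ?_⟩
  rw [hsum, ← AEMeasurable.map_map_of_aemeasurable hms.aemeasurable hae, hmap,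
    ← stdGaussian_eq_map_pi_orthonormalBasis]

theorem sum_nonneg_window {M : Type*} [AddCommMonoid M] (n : ℕ) (f : ℤ → M) :
    ∑ i : Finset.Icc (-(n : ℤ)) n, (if 0 ≤ (i : ℤ) then f i else 0) =
      ∑ t ∈ Finset.range (n + 1), f t := by
  rw [Finset.sum_coe_sort (Finset.Icc (-(n : ℤ)) n) fun i => if 0 ≤ i then f i else 0,
    ← Finset.sum_filter]
  refine Finset.sum_nbij' (fun i => i.toNat) (fun t => (t : ℤ)) ?_ ?_ ?_ ?_ ?_
  · intro i hi
    simp only [Finset.mem_filter, Finset.mem_Icc, Finset.mem_range] at hi ⊢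
    omega
  · intro t ht
    simp only [Finset.mem_filter, Finset.mem_Icc, Finset.mem_range] at ht ⊢
    omega
  · intro i hi
    simp only [Finset.mem_filter, Finset.mem_Icc] at hi
    omega
  · intro t _
    simp
  · intro i hi
    simp only [Finset.mem_filter, Finset.mem_Icc] at hi
    rw [Int.toNat_of_nonneg hi.2]

/-- The restriction of a sequence to `[0, n]`, as a vector supported on `[0, n] ⊆ [-n, n]`. -/
def cut (n : ℕ) : (ℤ → ℂ) →ₗ[ℂ] Win n where
  toFun x := WithLp.toLp 2 fun i => if 0 ≤ (i : ℤ) then x i else 0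
  map_add' x y := by
    ext i
    by_cases h : 0 ≤ (i : ℤ) <;> simp [h]
  map_smul' c x := by
    ext i
    by_cases h : 0 ≤ (i : ℤ) <;> simp [h]

theorem cut_apply (n : ℕ) (x : ℤ → ℂ) (i : Finset.Icc (-(n : ℤ)) n) :
    cut n x i = if 0 ≤ (i : ℤ) then x i else 0 := rfl

theorem inner_cut (n : ℕ) (x y : ℤ → ℂ) :
    ⟪cut n x, cut n y⟫ = ∑ t ∈ Finset.range (n + 1), (starRingEnd ℂ) (x t) * y t := by
  rw [← sum_nonneg_window n fun t => (starRingEnd ℂ) (x t) * y t, PiLp.inner_apply]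
  refine Finset.sum_congr rfl fun i _ => ?_
  by_cases hi : 0 ≤ (i : ℤ) <;> simp [cut_apply, hi, mul_comm]

theorem norm_cut (n : ℕ) (x : ℤ → ℂ) : ‖cut n x‖ = normTwo n x := by
  rw [normTwo, ← sum_nonneg_window n fun t => ‖x t‖ ^ 2, EuclideanSpace.norm_eq]
  congr 1
  refine Finset.sum_congr rfl fun i _ => ?_
  by_cases hi : 0 ≤ (i : ℤ) <;> simp [cut_apply, hi]

theorem inner_win_cut (n : ℕ) (z x : ℤ → ℂ) : ⟪win n z, cut n x⟫ = ⟪cut n z, cut n x⟫ := by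
  simp only [PiLp.inner_apply]
  refine Finset.sum_congr rfl fun i _ => ?_
  by_cases hi : 0 ≤ (i : ℤ) <;> simp [cut_apply, hi]

/-- The vector representing `v ↦ [φ * v]_t` on the window. -/
def row (n : ℕ) (φ : ℤ → ℂ) (t : ℤ) : Win n :=
  WithLp.toLp 2 fun j => (starRingEnd ℂ) (φ (t - j))

theorem sum_window_eq {M : Type*} [AddCommMonoid M] {n m : ℕ} {t : ℤ} (h1 : -(n : ℤ) ≤ t - m)
    (h2 : t ≤ n) (f : ℤ → M) (hf : ∀ j : ℤ, j ∉ Finset.Icc (t - m) t → f j = 0) :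
    ∑ j : Finset.Icc (-(n : ℤ)) n, f j = ∑ u ∈ Finset.Icc (t - m) t, f u := by
  rw [Finset.sum_coe_sort (Finset.Icc (-(n : ℤ)) n) f]
  exact (Finset.sum_subset (Finset.Icc_subset_Icc h1 h2) fun j _ hj => hf j hj).symm

theorem conv_eq_inner_row {n m : ℕ} {φ : ℤ → ℂ} (hφ : φ ∈ supportedOn 0 m) {t : ℤ}
    (h1 : -(n : ℤ) ≤ t - m) (h2 : t ≤ n) (z : ℤ → ℂ) :
    conv φ z t = ⟪row n φ t, win n z⟫ := by
  rw [conv_eq_sum hφ, PiLp.inner_apply,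
    ← sum_window_eq h1 h2 (fun u => φ (t - u) * z u) fun j hj => ?_]
  · refine Finset.sum_congr rfl fun i _ => ?_
    simp [row, mul_comm]
  · rw [hφ _ (by simp only [Finset.mem_Icc, Set.mem_Icc] at hj ⊢; omega), zero_mul]

theorem norm_row_sq {n m : ℕ} {φ : ℤ → ℂ} (hφ : φ ∈ supportedOn 0 m) {t : ℤ}
    (h1 : -(n : ℤ) ≤ t - m) (h2 : t ≤ n) : ‖row n φ t‖ ^ 2 = normTwo m φ ^ 2 := by
  rw [normTwo_sq_eq m φ t, EuclideanSpace.norm_sq_eq,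
    ← sum_window_eq h1 h2 (fun u => ‖φ (t - u)‖ ^ 2) fun j hj => ?_]
  · refine Finset.sum_congr rfl fun i _ => ?_
    simp [row]
  · rw [hφ _ (by simp only [Finset.mem_Icc, Set.mem_Icc] at hj ⊢; omega)]
    simp

/-- The convolution with `φ` from the window `[-n, n]` to `[0, n]`. -/
def convOp (n : ℕ) (φ : ℤ → ℂ) : Win n →ₗ[ℂ] Win n where
  toFun v := WithLp.toLp 2 fun i => if 0 ≤ (i : ℤ) then ⟪row n φ i, v⟫ else 0
  map_add' x y := by
    ext i
    by_cases h : 0 ≤ (i : ℤ) <;> simp [h]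
  map_smul' c x := by
    ext i
    by_cases h : 0 ≤ (i : ℤ) <;> simp [h]

theorem convOp_apply (n : ℕ) (φ : ℤ → ℂ) (v : Win n) (i : Finset.Icc (-(n : ℤ)) n) :
    convOp n φ v i = if 0 ≤ (i : ℤ) then ⟪row n φ i, v⟫ else 0 := rfl

theorem convOp_win {n : ℕ} {φ : ℤ → ℂ} (hφ : φ ∈ supportedOn 0 n) (z : ℤ → ℂ) :
    convOp n φ (win n z) = cut n (conv φ z) := by
  ext i
  have := (Finset.mem_Icc.1 i.2).2
  by_cases hi : 0 ≤ (i : ℤ)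
  · rw [convOp_apply, cut_apply, if_pos hi, if_pos hi,
      conv_eq_inner_row hφ (by omega) this]
  · simp [convOp_apply, cut_apply, hi]

theorem norm_convOp_sq (n : ℕ) (φ : ℤ → ℂ) (v : Win n) :
    ‖convOp n φ v‖ ^ 2 = ∑ t ∈ Finset.range (n + 1), ‖⟪row n φ t, v⟫‖ ^ 2 := by
  rw [EuclideanSpace.norm_sq_eq, ← sum_nonneg_window n fun t => ‖⟪row n φ t, v⟫‖ ^ 2]
  refine Finset.sum_congr rfl fun i _ => ?_
  by_cases hi : 0 ≤ (i : ℤ) <;> simp [convOp_apply, hi]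

theorem sum_norm_row_sq {n : ℕ} {φ : ℤ → ℂ} (hφ : φ ∈ supportedOn 0 n) :
    ∑ t ∈ Finset.range (n + 1), ‖row n φ t‖ ^ 2 = (n + 1) * normTwo n φ ^ 2 := by
  rw [Finset.sum_congr rfl fun (t : ℕ) ht =>
    norm_row_sq (n := n) hφ (t := (t : ℤ)) (by omega)
    (by have := Finset.mem_range.1 ht; omega)]
  simp

theorem sum_norm_convOp_sq {n : ℕ} {φ : ℤ → ℂ} (hφ : φ ∈ supportedOn 0 n) :
    ∑ j, ‖convOp n φ (stdBasis j)‖ ^ 2 = (n + 1) * normTwo n φ ^ 2 := by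
  rw [← sum_norm_row_sq hφ]
  simp only [norm_convOp_sq]
  rw [Finset.sum_comm]
  refine Finset.sum_congr rfl fun t _ => ?_
  rw [EuclideanSpace.norm_sq_eq]
  refine Finset.sum_congr rfl fun j _ => ?_
  simp [stdBasis, EuclideanSpace.inner_single_right]

/-- The matrix is Toeplitz with diagonal entry `φ 0` on the `n + 1` rows in `[0, n]`; the other rows
vanish. -/
theorem sum_inner_convOp (n : ℕ) (φ : ℤ → ℂ) :
    ∑ j, ⟪stdBasis j, convOp n φ (stdBasis j)⟫ = (n + 1) * φ 0 := by
  have h : ∀ j : Finset.Icc (-(n : ℤ)) n, ⟪stdBasis j, convOp n φ (stdBasis j)⟫ =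
      if 0 ≤ (j : ℤ) then φ 0 else 0 := fun j => by
    rw [EuclideanSpace.inner_single_left, convOp_apply]
    by_cases hj : 0 ≤ (j : ℤ) <;> simp [hj, stdBasis, EuclideanSpace.inner_single_right, row]
  simp only [h]
  rw [sum_nonneg_window n fun _ => φ 0]
  simp

/-- Tail of the quadratic form `⟪z - Πz, φ * z⟫` on `[0, n]`, `Π` an orthogonal projection. -/
theorem inner_convOp_tail {n : ℕ} {φ : ℤ → ℂ} (hφ : φ ∈ supportedOn 0 n)
    (K : Submodule ℂ (Win n)) {s : ℕ} (hs : Module.finrank ℂ K ≤ s) {u F τ : ℝ}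
    (hF0 : 0 ≤ F) (hF : (n + 1) * normTwo n φ ^ 2 ≤ F ^ 2)
    (hτ : (n + 1) * ‖φ 0‖ + √s * F ≤ τ) :
    (stdGaussian (Win n)).real
      {v | 4 * τ + 8 * F * (1 + u) < ‖⟪v - K.starProjection v, convOp n φ v⟫‖} ≤
      4 * Real.exp (-u) := by
  set T : Win n →ₗ[ℂ] Win n := (LinearMap.id - K.starProjection.toLinearMap) ∘ₗ convOp n φ with hT
  have hsym : ∀ v w, ⟪v, w - K.starProjection w⟫ = ⟪v - K.starProjection v, w⟫ := fun v w => by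
    rw [inner_sub_right, inner_sub_left, K.inner_starProjection_left_eq_right]
  have hTv : ∀ v w, ⟪v, T w⟫ = ⟪v - K.starProjection v, convOp n φ w⟫ := fun v w => by
    rw [← hsym]; rfl
  have hcon : ∀ w, ‖w - K.starProjection w‖ ≤ ‖w‖ := fun w => by
    rw [← Submodule.starProjection_orthogonal_val]
    exact Submodule.norm_starProjection_apply_le _ w
  have hC := sum_norm_convOp_sq hφ
  have hTF : ∑ i, ‖T (stdBasis i)‖ ^ 2 ≤ F ^ 2 := by
    refine le_trans (Finset.sum_le_sum fun i _ => ?_) (hC.le.trans hF)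
    exact pow_le_pow_left₀ (norm_nonneg _) (hcon _) 2
  have htr : ‖∑ i, ⟪stdBasis i, T (stdBasis i)⟫‖ ≤ τ := by
    -- The trace splits into that of the convolution and that of its product with the projection.
    -- The latter is at most the product of the two Hilbert-Schmidt norms, `√s * F`.
    simp only [hTv, inner_sub_left, Finset.sum_sub_distrib, sum_inner_convOp]
    refine (norm_sub_le _ _).trans (le_trans (add_le_add (le_of_eq ?_) ?_) hτ)
    · rw [norm_mul]
      congr 1
      exact_mod_cast Complex.norm_natCast (n + 1)
    · refine (norm_sum_le _ _).trans ((Finset.sum_le_sum fun i _ => norm_inner_le_norm _ _).trans ?_)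
      have hcs := Finset.sum_mul_sq_le_sq_mul_sq Finset.univ
        (fun i => ‖K.starProjection (stdBasis i)‖) fun i => ‖convOp n φ (stdBasis i)‖
      rw [sum_sq_norm_starProjection, hC] at hcs
      refine (abs_le_of_sq_le_sq' (hcs.trans ?_) (by positivity)).2
      rw [mul_pow, Real.sq_sqrt (by positivity)]
      have : (Module.finrank ℂ K : ℝ) ≤ s := by exact_mod_cast hs
      gcongr
  have hτ0 : 0 ≤ τ := le_trans (by positivity) hτ
  simpa only [hTv] using norm_inner_map_tail T (u := u) hF0 hTF hτ0 htr

end Window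

/-! ### Discrete Fourier analysis of filters on `[0, n]`. -/

section Fourier

theorem conv_eq_sum_range {n : ℕ} {φ : ℤ → ℂ} (hφ : φ ∈ supportedOn 0 n) (v : ℤ → ℂ) (t : ℤ) :
    conv φ v t = ∑ j ∈ Finset.range (n + 1), φ j * v (t - j) := by
  rw [conv_eq_sum hφ]
  refine Finset.sum_nbij' (fun u => (t - u).toNat) (fun j => t - (j : ℤ)) ?_ ?_ ?_ ?_ ?_
  · intro u hu
    simp only [Finset.mem_Icc, Finset.mem_range] at hu ⊢
    omega
  · intro j hj
    simp only [Finset.mem_Icc, Finset.mem_range] at hj ⊢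
    omega
  · intro u hu
    simp only [Finset.mem_Icc] at hu
    omega
  · intro j _
    simp
  · intro u hu
    simp only [Finset.mem_Icc] at hu
    rw [Int.toNat_of_nonneg (by omega)]
    simp

theorem supportedOn_mono {m n : ℕ} (h : m ≤ n) {φ : ℤ → ℂ} (hφ : φ ∈ supportedOn 0 m) :
    φ ∈ supportedOn 0 n := fun t ht => hφ t (by simp only [Set.mem_Icc] at ht ⊢; omega)

theorem sum_range_shift {M : Type*} [AddCommMonoid M] {m n j : ℕ} (hj : j + m ≤ n) (f : ℤ → M)
    (hf : ∀ t : ℤ, t ∉ Set.Icc (0 : ℤ) m → f t = 0) :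
    ∑ t ∈ Finset.range (n + 1), f (t - j) = ∑ i ∈ Finset.range (m + 1), f i := by
  refine (Finset.sum_of_injOn (fun i => i + j) (fun a _ b _ h => Nat.add_right_cancel h) ?_ ?_
    ?_).symm
  · intro i hi
    simp only [Finset.coe_range, Set.mem_Iio] at hi ⊢
    omega
  · intro t _ ht
    refine hf _ fun hmem => ht ⟨t - j, ?_, ?_⟩
    · simp only [Set.mem_Icc, Finset.coe_range, Set.mem_Iio] at hmem ⊢
      omega
    · simp only [Set.mem_Icc] at hmem
      simp only
      omega
  · intro i _
    simp

theorem normTwo_of_supportedOn {m n : ℕ} (h : m ≤ n) {φ : ℤ → ℂ} (hφ : φ ∈ supportedOn 0 m) :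
    normTwo n φ = normTwo m φ := by
  have := sum_range_shift (j := 0) (by omega : 0 + m ≤ n) (fun t => ‖φ t‖ ^ 2)
    fun t ht => by simp [hφ t ht]
  simp only [Nat.cast_zero, sub_zero] at this
  rw [normTwo, normTwo, this]

/-- The additive character `exp (2 π i k t / (n+1))`. -/
def chi (n k : ℕ) (t : ℤ) : ℂ := Complex.exp (2 * Real.pi * Complex.I * k * t / (n + 1))

theorem chi_add (n k : ℕ) (s t : ℤ) : chi n k (s + t) = chi n k s * chi n k t := by
  rw [chi, chi, chi, ← Complex.exp_add]
  push_cast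
  ring_nf

theorem norm_chi (n k : ℕ) (t : ℤ) : ‖chi n k t‖ = 1 := by
  have : (2 * Real.pi * Complex.I * k * t / (n + 1) : ℂ) =
      ((2 * Real.pi * k * t / (n + 1) : ℝ) : ℂ) * Complex.I := by
    push_cast; ring
  rw [chi, this, Complex.norm_exp_ofReal_mul_I]

theorem conj_chi (n k : ℕ) (t : ℤ) : (starRingEnd ℂ) (chi n k t) = chi n k (-t) := by
  rw [chi, chi, ← Complex.exp_conj]
  simp [map_ofNat]

/-- For `t ≠ 0` this is a geometric sum in a root of unity of order dividing `n + 1`, distinct from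
`1` because `|t| < n + 1`. -/
theorem sum_chi (n : ℕ) {t : ℤ} (h1 : -(n : ℤ) ≤ t) (h2 : t ≤ n) :
    ∑ k ∈ Finset.range (n + 1), chi n k t = if t = 0 then (n : ℂ) + 1 else 0 := by
  have hN : (n : ℂ) + 1 ≠ 0 := by exact_mod_cast Nat.succ_ne_zero n
  split_ifs with h
  · simp [h, chi]
  set w := Complex.exp (2 * Real.pi * Complex.I * t / (n + 1)) with hw
  have hk : ∀ k : ℕ, chi n k t = w ^ k := fun k => by
    rw [chi, hw, ← Complex.exp_nat_mul]
    ring_nf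
  simp only [hk]
  have hw1 : w ≠ 1 := fun h1 => by
    obtain ⟨l, hl⟩ := Complex.exp_eq_one_iff.1 h1
    have hpi : (2 * Real.pi * Complex.I : ℂ) ≠ 0 := Complex.two_pi_I_ne_zero
    rw [div_eq_iff hN] at hl
    have h3 : (t : ℂ) = l * (n + 1) := mul_left_cancel₀ hpi (by rw [hl]; ring)
    have h4 : t = l * (n + 1) := by exact_mod_cast h3
    have h5 : l ≠ 0 := by rintro rfl; simp at h4; exact h h4
    rcases lt_or_gt_of_ne h5 with h6 | h6 <;> nlinarith
  have hwN : w ^ (n + 1) = 1 := by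
    rw [hw, ← Complex.exp_nat_mul, Complex.exp_eq_one_iff]
    refine ⟨t, ?_⟩
    push_cast
    field_simp
  have := mul_neg_geom_sum w (n + 1)
  rw [hwN, sub_self] at this
  exact (mul_eq_zero.1 this).resolve_left (sub_ne_zero.2 hw1.symm)

theorem dft_eq (n : ℕ) (z : ℤ → ℂ) (k : ℕ) :
    dft n z k = ((√((n : ℝ) + 1))⁻¹ : ℂ) * ∑ t ∈ Finset.range (n + 1), z t * chi n k t := by
  simp [dft, chi]

theorem inv_sqrt_mul_self (n : ℕ) :
    ((√((n : ℝ) + 1))⁻¹ : ℂ) * ((√((n : ℝ) + 1))⁻¹ : ℂ) = ((n : ℂ) + 1)⁻¹ := by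
  rw [← mul_inv, ← Complex.ofReal_mul, Real.mul_self_sqrt (by positivity)]
  simp

/-- The Fourier filters `(n+1)^{-1/2} exp (-2 π i k t / (n+1))` on `[0, n]`. -/
def fourierFilter (n k : ℕ) : ℤ → ℂ :=
  fun t => if t ∈ Set.Icc (0 : ℤ) n then ((√((n : ℝ) + 1))⁻¹ : ℂ) * chi n k (-t) else 0

theorem fourierFilter_mem (n k : ℕ) : fourierFilter n k ∈ supportedOn 0 n := fun _ ht => if_neg ht

theorem norm_fourierFilter {n k : ℕ} {t : ℤ} (ht : t ∈ Set.Icc (0 : ℤ) n) :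
    ‖fourierFilter n k t‖ = (√((n : ℝ) + 1))⁻¹ := by
  rw [fourierFilter, if_pos ht, norm_mul, norm_chi, mul_one, ← Complex.ofReal_inv,
    Complex.norm_real, Real.norm_of_nonneg (by positivity)]

theorem normTwo_fourierFilter (n k : ℕ) : normTwo n (fourierFilter n k) ^ 2 = 1 := by
  rw [normTwo, Real.sq_sqrt (by positivity), Finset.sum_congr rfl fun (t : ℕ) ht => by
    rw [norm_fourierFilter ⟨by omega, by have := Finset.mem_range.1 ht; omega⟩]]
  rw [inv_pow, Real.sq_sqrt (by positivity)]
  simp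
  field_simp

/-- Exhibits a filter as a combination of `n + 1` fixed filters whose weights have `ℓ₁`-norm
`specNormOne n φ`. Uniform control over the feasible set reduces to these filters. -/
theorem dft_inversion {n : ℕ} {φ : ℤ → ℂ} (hφ : φ ∈ supportedOn 0 n) :
    φ = ∑ k ∈ Finset.range (n + 1), dft n φ k • fourierFilter n k := by
  have hN : (n : ℂ) + 1 ≠ 0 := by exact_mod_cast Nat.succ_ne_zero n
  ext t
  simp only [Finset.sum_apply, Pi.smul_apply, smul_eq_mul]
  by_cases ht : t ∈ Set.Icc (0 : ℤ) n
  · simp only [fourierFilter, if_pos ht, dft_eq]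
    have h1 : ∀ k, ((√((n : ℝ) + 1))⁻¹ : ℂ) * (∑ s ∈ Finset.range (n + 1), φ s * chi n k s) *
        (((√((n : ℝ) + 1))⁻¹ : ℂ) * chi n k (-t)) =
        ((n : ℂ) + 1)⁻¹ * ∑ s ∈ Finset.range (n + 1), φ s * chi n k (s - t) := fun k => by
      rw [← inv_sqrt_mul_self, mul_mul_mul_comm, Finset.sum_mul]
      congr 1
      refine Finset.sum_congr rfl fun s _ => ?_
      rw [sub_eq_add_neg, chi_add, mul_assoc]
    simp only [h1]
    rw [← Finset.mul_sum, Finset.sum_comm]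
    simp only [← Finset.mul_sum]
    obtain ⟨ht0, htn⟩ := ht
    rw [Finset.sum_eq_single t.toNat]
    · rw [Int.toNat_of_nonneg ht0, sub_self, sum_chi n (by omega) (by omega), if_pos rfl]
      field_simp
    · intro s hs hst
      have := Finset.mem_range.1 hs
      rw [sum_chi n (by omega) (by omega), if_neg (by omega), mul_zero]
    · intro h
      exact absurd (Finset.mem_range.2 (by omega)) h
  · rw [hφ t ht]
    exact (Finset.sum_eq_zero fun k _ => by rw [fourierFilter, if_neg ht, mul_zero]).symm

theorem sum_norm_dft_sq {n : ℕ} {φ : ℤ → ℂ} (hφ : φ ∈ supportedOn 0 n) :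
    ∑ k ∈ Finset.range (n + 1), ‖dft n φ k‖ ^ 2 = normTwo n φ ^ 2 := by
  have hN : (n : ℂ) + 1 ≠ 0 := by exact_mod_cast Nat.succ_ne_zero n
  rw [normTwo, Real.sq_sqrt (by positivity), ← Complex.ofReal_inj]
  have h1 : ∀ z : ℂ, ((‖z‖ ^ 2 : ℝ) : ℂ) = z * (starRingEnd ℂ) z := fun z => by
    rw [Complex.mul_conj, Complex.normSq_eq_norm_sq]
  rw [Complex.ofReal_sum, Complex.ofReal_sum]
  simp only [h1]
  symm
  calc ∑ t ∈ Finset.range (n + 1), φ t * (starRingEnd ℂ) (φ t)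
      = ∑ t ∈ Finset.range (n + 1), ∑ k ∈ Finset.range (n + 1),
          dft n φ k * fourierFilter n k t * (starRingEnd ℂ) (φ t) := by
        refine Finset.sum_congr rfl fun t _ => ?_
        conv_lhs => enter [1]; rw [dft_inversion hφ]
        simp only [Finset.sum_apply, Pi.smul_apply, smul_eq_mul, Finset.sum_mul]
    _ = _ := by
        rw [Finset.sum_comm]
        refine Finset.sum_congr rfl fun k _ => ?_
        simp only [mul_assoc]
        rw [← Finset.mul_sum]
        congr 1
        rw [dft_eq, map_mul, map_sum, Finset.mul_sum, map_inv₀, Complex.conj_ofReal]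
        refine Finset.sum_congr rfl fun t ht => ?_
        rw [fourierFilter, if_pos ⟨by omega, by have := Finset.mem_range.1 ht; omega⟩, map_mul,
          conj_chi]
        ring

theorem conv_self_mem {m n : ℕ} (hn : n = 2 * m) {φ : ℤ → ℂ} (hφ : φ ∈ supportedOn 0 m) :
    conv φ φ ∈ supportedOn 0 n := fun t ht => by
  rw [conv_eq_sum_range hφ]
  refine Finset.sum_eq_zero fun j hj => ?_
  have := Finset.mem_range.1 hj
  rw [hφ (t - j) (by simp only [Set.mem_Icc] at ht ⊢; omega), mul_zero]

/-- The support of `φ * φ` lies in `[0, 2m]`, which fits in one period of length `n + 1`; the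
convolution theorem thus holds without aliasing. The factor `√(n+1)` comes from the unitary
normalization. -/
theorem dft_conv_self {m n : ℕ} (hn : n = 2 * m) {φ : ℤ → ℂ} (hφ : φ ∈ supportedOn 0 m) (k : ℕ) :
    dft n (conv φ φ) k = (√((n : ℝ) + 1) : ℂ) * dft n φ k ^ 2 := by
  have hs : (√((n : ℝ) + 1) : ℂ) ≠ 0 := by
    rw [Complex.ofReal_ne_zero]; positivity
  have h0 : ∀ t : ℤ, t ∉ Set.Icc (0 : ℤ) m → φ t * chi n k t = 0 := fun t ht => by
    rw [hφ t ht, zero_mul]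
  have h1 : ∑ t ∈ Finset.range (n + 1), conv φ φ t * chi n k t =
      (∑ t ∈ Finset.range (m + 1), φ t * chi n k t) ^ 2 := by
    simp only [conv_eq_sum_range hφ, Finset.sum_mul]
    rw [Finset.sum_comm, sq, Finset.sum_mul]
    refine Finset.sum_congr rfl fun j hj => ?_
    have := Finset.mem_range.1 hj
    rw [← sum_range_shift (j := j) (n := n) (by omega) _ h0, Finset.mul_sum]
    refine Finset.sum_congr rfl fun t _ => ?_
    rw [show chi n k t = chi n k j * chi n k (t - j) by rw [← chi_add]; congr 1; ring]
    ring
  have h2 := sum_range_shift (j := 0) (n := n) (by omega) _ h0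
  simp only [Nat.cast_zero, sub_zero] at h2
  rw [dft_eq, dft_eq, h1, h2]
  field_simp

theorem specNormOne_conv_self {m n : ℕ} (hn : n = 2 * m) {φ : ℤ → ℂ} (hφ : φ ∈ supportedOn 0 m) :
    specNormOne n (conv φ φ) = √((n : ℝ) + 1) * normTwo m φ ^ 2 := by
  rw [← normTwo_of_supportedOn (by omega : m ≤ n) hφ,
    ← sum_norm_dft_sq (supportedOn_mono (by omega : m ≤ n) hφ), Finset.mul_sum, specNormOne]
  refine Finset.sum_congr rfl fun k _ => ?_
  rw [dft_conv_self hn hφ, norm_mul, norm_pow, Complex.norm_real,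
    Real.norm_of_nonneg (by positivity)]

theorem normTwo_le_specNormOne {n : ℕ} {φ : ℤ → ℂ} (hφ : φ ∈ supportedOn 0 n) :
    normTwo n φ ≤ specNormOne n φ := by
  have h0 : 0 ≤ specNormOne n φ := Finset.sum_nonneg fun _ _ => norm_nonneg _
  refine (abs_le_of_sq_le_sq' ?_ h0).2
  rw [← sum_norm_dft_sq hφ]
  exact Finset.sum_sq_le_sq_sum_of_nonneg fun _ _ => norm_nonneg _

theorem norm_zero_le_specNormOne {n : ℕ} {φ : ℤ → ℂ} (hφ : φ ∈ supportedOn 0 n) :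
    ‖φ 0‖ ≤ specNormOne n φ * (√((n : ℝ) + 1))⁻¹ := by
  conv_lhs => rw [dft_inversion hφ]
  simp only [Finset.sum_apply, Pi.smul_apply, smul_eq_mul]
  refine (norm_sum_le _ _).trans (le_of_eq ?_)
  rw [specNormOne, Finset.sum_mul]
  refine Finset.sum_congr rfl fun k _ => ?_
  rw [norm_mul, norm_fourierFilter ⟨le_rfl, by omega⟩]

theorem sum_norm_le_sqrt_mul_normTwo (n : ℕ) (φ : ℤ → ℂ) :
    ∑ t ∈ Finset.range (n + 1), ‖φ t‖ ≤ √((n : ℝ) + 1) * normTwo n φ := by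
  have h := Finset.sum_mul_sq_le_sq_mul_sq (Finset.range (n + 1)) (fun _ => (1 : ℝ))
    fun t => ‖φ (t : ℤ)‖
  simp only [one_mul, one_pow, Finset.sum_const, Finset.card_range, nsmul_eq_mul, mul_one] at h
  rw [normTwo, ← Real.sqrt_mul (by positivity)]
  exact Real.le_sqrt_of_sq_le (by exact_mod_cast h)

end Fourier

/-! ### Convolution algebra, the oracle filter and the noise conditions. -/

section Deterministic

open scoped ComplexInnerProductSpace

theorem shift_pow_apply (τ : ℕ) (v : ℤ → ℂ) (t : ℤ) : (shift ^ τ) v t = v (t - τ) := by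
  induction τ generalizing t with
  | zero => simp
  | succ k ih =>
    rw [pow_succ', Module.End.mul_apply]
    change (shift ^ k) v (t - 1) = _
    rw [ih]
    push_cast
    congr 1
    ring

theorem conv_eq_sum_shift {n : ℕ} {φ : ℤ → ℂ} (hφ : φ ∈ supportedOn 0 n) (v : ℤ → ℂ) :
    conv φ v = ∑ j ∈ Finset.range (n + 1), φ j • (shift ^ j) v := by
  ext t
  simp only [conv_eq_sum_range hφ, Finset.sum_apply, Pi.smul_apply, shift_pow_apply, smul_eq_mul]

theorem conv_add_right {n : ℕ} {φ : ℤ → ℂ} (hφ : φ ∈ supportedOn 0 n) (v w : ℤ → ℂ) :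
    conv φ (v + w) = conv φ v + conv φ w := by
  simp only [conv_eq_sum_shift hφ, map_add, smul_add, Finset.sum_add_distrib]

theorem conv_sub_right {n : ℕ} {φ : ℤ → ℂ} (hφ : φ ∈ supportedOn 0 n) (v w : ℤ → ℂ) :
    conv φ (v - w) = conv φ v - conv φ w := by
  simp only [conv_eq_sum_shift hφ, map_sub, smul_sub, Finset.sum_sub_distrib]

theorem conv_smul_right {n : ℕ} {φ : ℤ → ℂ} (hφ : φ ∈ supportedOn 0 n) (c : ℂ) (v : ℤ → ℂ) :
    conv φ (c • v) = c • conv φ v := by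
  simp only [conv_eq_sum_shift hφ, map_smul, Finset.smul_sum, smul_comm c]

theorem conv_conv_comm {n m : ℕ} {φ ψ : ℤ → ℂ} (hφ : φ ∈ supportedOn 0 n)
    (hψ : ψ ∈ supportedOn 0 m) (v : ℤ → ℂ) : conv φ (conv ψ v) = conv ψ (conv φ v) := by
  ext t
  simp only [conv_eq_sum_range hφ, conv_eq_sum_range hψ, Finset.mul_sum]
  rw [Finset.sum_comm]
  refine Finset.sum_congr rfl fun i _ => Finset.sum_congr rfl fun j _ => ?_
  rw [show t - (i : ℤ) - j = t - j - i by ring]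
  ring

theorem conv_conv_self {m n : ℕ} (hn : n = 2 * m) {φ : ℤ → ℂ} (hφ : φ ∈ supportedOn 0 m)
    (v : ℤ → ℂ) : conv (conv φ φ) v = conv φ (conv φ v) := by
  ext t
  rw [conv_eq_sum_range (conv_self_mem hn hφ), conv_eq_sum_range hφ]
  simp only [conv_eq_sum_range hφ, Finset.sum_mul, Finset.mul_sum]
  rw [Finset.sum_comm]
  refine Finset.sum_congr rfl fun j hj => ?_
  have := Finset.mem_range.1 hj
  have h := sum_range_shift (j := j) (m := m) (n := n) (by omega)
    (fun i => φ j * φ i * v (t - j - i)) fun i hi => by simp [hφ i hi]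
  rw [Finset.sum_congr rfl fun (i : ℕ) _ => (mul_assoc (φ j) (φ i) (v (t - j - i))).symm, ← h]
  refine Finset.sum_congr rfl fun i _ => ?_
  congr 2
  ring

theorem observe_eq (σ : ℝ) (x z : ℤ → ℂ) : observe σ x z = x + (σ : ℂ) • z := rfl

theorem conv_observe {n : ℕ} {φ : ℤ → ℂ} (hφ : φ ∈ supportedOn 0 n) (σ : ℝ) (x z : ℤ → ℂ) :
    conv φ (observe σ x z) = conv φ x + (σ : ℂ) • conv φ z := by
  rw [observe_eq, conv_add_right hφ, conv_smul_right hφ]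

theorem conv_eq_sum_dft {n : ℕ} {φ : ℤ → ℂ} (hφ : φ ∈ supportedOn 0 n) (v : ℤ → ℂ) :
    conv φ v = ∑ k ∈ Finset.range (n + 1), dft n φ k • conv (fourierFilter n k) v := by
  ext t
  simp only [Finset.sum_apply, Pi.smul_apply, conv_eq_sum_range (fourierFilter_mem n _),
    Finset.smul_sum, conv_eq_sum_range hφ]
  rw [Finset.sum_comm]
  refine Finset.sum_congr rfl fun j _ => ?_
  conv_lhs => enter [1]; rw [dft_inversion hφ]
  simp only [Finset.sum_apply, Pi.smul_apply, smul_eq_mul, Finset.sum_mul, mul_assoc]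

/-- A functional linear in the filter is bounded by its maximum over the Fourier filters times the
spectral `ℓ₁`-norm. This is what allows `φ` to depend on the noise. -/
theorem norm_conv_le_specNormOne {n : ℕ} {φ : ℤ → ℂ} (hφ : φ ∈ supportedOn 0 n) (v : ℤ → ℂ)
    (t : ℤ) {M : ℝ} (hM : ∀ k ∈ Finset.range (n + 1), ‖conv (fourierFilter n k) v t‖ ≤ M) :
    ‖conv φ v t‖ ≤ specNormOne n φ * M := by
  rw [conv_eq_sum_dft hφ, Finset.sum_apply, specNormOne, Finset.sum_mul]
  refine (norm_sum_le _ _).trans (Finset.sum_le_sum fun k hk => ?_)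
  rw [Pi.smul_apply, norm_smul]
  exact mul_le_mul_of_nonneg_left (hM k hk) (norm_nonneg _)

theorem norm_inner_cut_conv_le {n : ℕ} {φ : ℤ → ℂ} (hφ : φ ∈ supportedOn 0 n) (v : ℤ → ℂ)
    (w : Win n) {M : ℝ}
    (hM : ∀ k ∈ Finset.range (n + 1), ‖⟪w, cut n (conv (fourierFilter n k) v)⟫‖ ≤ M) :
    ‖⟪w, cut n (conv φ v)⟫‖ ≤ specNormOne n φ * M := by
  rw [conv_eq_sum_dft hφ, map_sum, inner_sum, specNormOne, Finset.sum_mul]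
  refine (norm_sum_le _ _).trans (Finset.sum_le_sum fun k hk => ?_)
  rw [map_smul, inner_smul_right, norm_mul]
  exact mul_le_mul_of_nonneg_left (hM k hk) (norm_nonneg _)

theorem norm_conv_le_normTwo {n : ℕ} {φ : ℤ → ℂ} (hφ : φ ∈ supportedOn 0 n) (v : ℤ → ℂ) (t : ℤ) :
    ‖conv φ v t‖ ^ 2 ≤ normTwo n φ ^ 2 * ∑ u ∈ Finset.Icc (t - n) t, ‖v u‖ ^ 2 := by
  rw [conv_eq_sum hφ, normTwo_sq_eq n φ t]
  refine (pow_le_pow_left₀ (norm_nonneg _) (norm_sum_le _ _) 2).trans ?_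
  simp only [norm_mul]
  exact Finset.sum_mul_sq_le_sq_mul_sq _ _ _

theorem norm_conv_le_of_bound {n : ℕ} {φ : ℤ → ℂ} (hφ : φ ∈ supportedOn 0 n) (v : ℤ → ℂ) (t : ℤ)
    {M : ℝ} (hM : ∀ u : ℤ, t - n ≤ u → u ≤ t → ‖v u‖ ≤ M) :
    ‖conv φ v t‖ ≤ √((n : ℝ) + 1) * normTwo n φ * M := by
  have hM0 : 0 ≤ M := (norm_nonneg _).trans (hM t (by omega) le_rfl)
  refine le_trans ?_ (mul_le_mul_of_nonneg_right (sum_norm_le_sqrt_mul_normTwo n φ) hM0)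
  rw [conv_eq_sum_range hφ, Finset.sum_mul]
  refine (norm_sum_le _ _).trans (Finset.sum_le_sum fun j hj => ?_)
  have := Finset.mem_range.1 hj
  rw [norm_mul]
  exact mul_le_mul_of_nonneg_left (hM _ (by omega) (by omega)) (norm_nonneg _)

/-- The bounds on the restriction `v` of the noise to `[-n, n]` under which the risk bounds hold.
Here `K` is the restriction of the shift-invariant subspace to `[0, n]`, `ϕ` is the filter from the
definition of a simple signal, and `u`, `u'` are confidence levels. -/
structure NoiseBound (m n s : ℕ) (ϱ σ ϰ u u' : ℝ) (K : Submodule ℂ (Win n)) (ϕ x ε : ℤ → ℂ)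
    (v : Win n) : Prop where
  proj : ‖K.starProjection v‖ ^ 2 ≤ 4 * (s + u)
  quad : ∀ k ∈ Finset.range (n + 1),
    ‖⟪v - K.starProjection v, convOp n (fourierFilter n k) v⟫‖ ≤
      4 * (√((n : ℝ) + 1) * (1 + √s)) + 8 * √((n : ℝ) + 1) * (1 + u')
  shifts : ∑ τ ∈ Finset.range (n + 1),
    ‖⟪cut n ((shift ^ τ) ε) - K.starProjection (cut n ((shift ^ τ) ε)), v⟫‖ ^ 2 ≤
      4 * ((n + 1) * (ϰ * σ) ^ 2) * (1 + u)
  residual : ‖⟪cut n ε - K.starProjection (cut n ε), v⟫‖ ^ 2 ≤ 4 * (ϰ * σ) ^ 2 * (1 + u)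
  bias : ‖⟪cut n (x - conv (conv ϕ ϕ) x), v⟫‖ ^ 2 ≤ 4 * (8 * (ϱ * σ) ^ 2) * (1 + u)
  quadOracle : ‖⟪v, convOp n (conv ϕ ϕ) v⟫‖ ≤ 4 * (2 * ϱ) + 8 * (2 * ϱ) * (1 + u)
  normOracle : ‖convOp n (conv ϕ ϕ) v‖ ^ 2 ≤ 4 * (2 * ϱ) ^ 2 * (1 + u)
  normSimple : ∑ t ∈ Finset.Icc (-(m : ℤ)) n, ‖⟪row n ϕ t, v⟫‖ ^ 2 ≤ 4 * (4 * ϱ) * (1 + u)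
  sup : ∀ k ∈ Finset.range (n + 1), ∀ t ∈ Finset.range (n + 1),
    ‖⟪row n (fourierFilter n k) t, v⟫‖ ^ 2 ≤ 4 * 1 * (1 + u')

/-- The factor `2` in the constraint radius comes from `n + 1 ≤ 2 (m + 1)`. -/
theorem feasible_conv_self {m n : ℕ} (hn : n = 2 * m) {ϱ : ℝ} {ϕ : ℤ → ℂ}
    (hϕ : ϕ ∈ supportedOn 0 m) (hnorm : normTwo m ϕ ^ 2 ≤ ϱ / (m + 1)) :
    conv ϕ ϕ ∈ feasible n (2 * ϱ) := by
  refine ⟨conv_self_mem hn hϕ, ?_⟩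
  rw [specNormOne_conv_self hn hϕ, le_div_iff₀ (by positivity), mul_right_comm,
    Real.mul_self_sqrt (by positivity)]
  rw [le_div_iff₀ (by positivity)] at hnorm
  have : (n : ℝ) = 2 * m := by exact_mod_cast hn
  nlinarith [sq_nonneg (normTwo m ϕ)]

theorem sq_norm_le_of_feasible {n : ℕ} {R : ℝ} {φ : ℤ → ℂ}
    (hφ : φ ∈ feasible n R) : √((n : ℝ) + 1) * normTwo n φ ≤ R := by
  have h := (normTwo_le_specNormOne hφ.1).trans hφ.2
  rwa [le_div_iff₀ (by positivity), mul_comm] at h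

theorem norm_zero_le_of_feasible {n : ℕ} {R : ℝ} {φ : ℤ → ℂ}
    (hφ : φ ∈ feasible n R) : ((n : ℝ) + 1) * ‖φ 0‖ ≤ R := by
  have h := (norm_zero_le_specNormOne hφ.1).trans
    (mul_le_mul_of_nonneg_right hφ.2 (by positivity))
  rw [← div_eq_mul_inv, div_div, Real.mul_self_sqrt (by positivity),
    le_div_iff₀ (by positivity), mul_comm] at h
  exact h

theorem normTwo_bias_le {m n : ℕ} (hn : n = 2 * m) {ϱ σ : ℝ} (hσ : 0 < σ) (hϱ : 1 ≤ ϱ)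
    {x ϕ : ℤ → ℂ} (hϕ : ϕ ∈ supportedOn 0 m) (hnorm : normTwo m ϕ ^ 2 ≤ ϱ / (m + 1))
    (hbias : ∀ t : ℤ, -(m : ℤ) ≤ t → t ≤ n → ‖x t - conv ϕ x t‖ ^ 2 ≤ ϱ * σ ^ 2 / (m + 1)) :
    normTwo n (x - conv (conv ϕ ϕ) x) ^ 2 ≤ 8 * (ϱ * σ) ^ 2 := by
  have hm : (0 : ℝ) < (m : ℝ) + 1 := by positivity
  set h : ℤ → ℂ := x - conv ϕ x with hh
  set M : ℝ := √(ϱ * σ ^ 2 / (m + 1)) with hM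
  have hM2 : M ^ 2 = ϱ * σ ^ 2 / (m + 1) := Real.sq_sqrt (by positivity)
  have hM0 : 0 ≤ M := Real.sqrt_nonneg _
  have hhM : ∀ t : ℤ, -(m : ℤ) ≤ t → t ≤ n → ‖h t‖ ≤ M := fun t h1 h2 =>
    Real.le_sqrt_of_sq_le (hbias t h1 h2)
  -- This is `1 - ϕ² = (1 - ϕ) + ϕ (1 - ϕ)` in the convolution algebra. On `[0, n]` the second term
  -- only looks at `h` on `[-m, n]`, where the bias is controlled.
  have hdec : x - conv (conv ϕ ϕ) x = h + conv ϕ h := by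
    rw [conv_conv_self hn hϕ, hh, conv_sub_right hϕ]
    abel
  have hN : √((m : ℝ) + 1) * normTwo m ϕ ≤ √ϱ := by
    apply Real.le_sqrt_of_sq_le
    rw [mul_pow, Real.sq_sqrt hm.le]
    rw [le_div_iff₀ hm] at hnorm
    linarith
  have hϱ2 : √ϱ ^ 2 = ϱ := Real.sq_sqrt (by linarith)
  have hϱ1 : 1 ≤ √ϱ := Real.one_le_sqrt.2 hϱ
  have hpt : ∀ t : ℕ, t ∈ Finset.range (n + 1) →
      ‖(x - conv (conv ϕ ϕ) x) (t : ℤ)‖ ^ 2 ≤ 4 * ϱ * (ϱ * σ ^ 2 / (m + 1)) := fun t ht => by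
    have := Finset.mem_range.1 ht
    have h1 : ‖(x - conv (conv ϕ ϕ) x) (t : ℤ)‖ ≤ 2 * √ϱ * M := by
      rw [hdec, Pi.add_apply]
      have h2 := hhM t (by omega) (by omega)
      have h3 := norm_conv_le_of_bound hϕ h t fun u hu1 hu2 => hhM u (by omega) (by omega)
      have h4 := mul_le_mul_of_nonneg_right hN hM0
      have h5 := mul_le_mul_of_nonneg_right hϱ1 hM0
      refine (norm_add_le _ _).trans ?_
      linarith
    refine (pow_le_pow_left₀ (norm_nonneg _) h1 2).trans (le_of_eq ?_)
    rw [mul_pow, mul_pow, hϱ2, hM2]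
    ring
  rw [normTwo, Real.sq_sqrt (by positivity)]
  refine (Finset.sum_le_sum hpt).trans ?_
  rw [Finset.sum_const, Finset.card_range, nsmul_eq_mul]
  push_cast
  have hn' : (n : ℝ) = 2 * m := by exact_mod_cast hn
  have h6 : ((n : ℝ) + 1) * (4 * ϱ * (ϱ * σ ^ 2 / (m + 1))) =
      (((n : ℝ) + 1) / (m + 1)) * (4 * (ϱ * σ) ^ 2) := by
    field_simp
  rw [h6]
  have h7 : ((n : ℝ) + 1) / (m + 1) ≤ 2 := by
    rw [div_le_iff₀ hm]
    linarith
  nlinarith [mul_le_mul_of_nonneg_right h7 (by positivity : 0 ≤ 4 * (ϱ * σ) ^ 2)]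

end Deterministic

/-! ### Risk bounds on the event where the noise conditions hold. -/

section Risk

open scoped ComplexInnerProductSpace

variable {m n s : ℕ} {ϱ σ ϰ u u' : ℝ} {K : Submodule ℂ (Win n)} {ϕ x ε z φ : ℤ → ℂ}

theorem sum_Icc_le_normTwo_sq (n : ℕ) (v : ℤ → ℂ) {a b : ℤ} (ha : 0 ≤ a) (hb : b ≤ n) :
    ∑ i ∈ Finset.Icc a b, ‖v i‖ ^ 2 ≤ normTwo n v ^ 2 := by
  rw [normTwo, Real.sq_sqrt (by positivity)]
  have h : ∑ t ∈ Finset.range (n + 1), ‖v (t : ℤ)‖ ^ 2 = ∑ i ∈ Finset.Icc (0 : ℤ) n, ‖v i‖ ^ 2 := by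
    refine Finset.sum_nbij' (fun t => (t : ℤ)) (fun i => i.toNat) ?_ ?_ ?_ ?_ ?_
    · intro t ht
      simp only [Finset.mem_Icc, Finset.mem_range] at ht ⊢
      omega
    · intro i hi
      simp only [Finset.mem_Icc, Finset.mem_range] at hi ⊢
      omega
    · intro t _
      simp
    · intro i hi
      simp only [Finset.mem_Icc] at hi
      omega
    · intro t _
      rfl
  rw [h]
  exact Finset.sum_le_sum_of_subset_of_nonneg (Finset.Icc_subset_Icc ha hb)
    fun _ _ _ => by positivity

/-- The basic inequality of least squares. -/
theorem norm_sq_le_of_isConstrainedLS (hσ : 0 < σ) {R : ℝ}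
    (hLS : IsConstrainedLS n R (observe σ x z) φ) {ψ : ℤ → ℂ} (hψ : ψ ∈ feasible n R) :
    ‖cut n (x - conv φ (observe σ x z))‖ ^ 2 ≤
      ‖cut n (x - conv ψ (observe σ x z))‖ ^ 2 +
        2 * σ * ‖⟪win n z, cut n (x - conv ψ (observe σ x z))⟫‖ +
        2 * σ * ‖⟪win n z, cut n (x - conv φ (observe σ x z))⟫‖ := by
  have hmin := hLS.2 hψ
  simp only [Set.mem_ofPred_eq, ← norm_cut] at hmin
  -- Both objective values contain the same term `‖σ z‖²`, which cancels after expanding the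
  -- squares.
  have hy : ∀ θ : ℤ → ℂ, cut n (observe σ x z - conv θ (observe σ x z)) =
      cut n (x - conv θ (observe σ x z)) + (σ : ℂ) • cut n z := fun θ => by
    rw [← map_smul, ← map_add]
    congr 1
    rw [observe_eq]
    abel
  rw [hy, hy, @norm_add_sq ℂ, @norm_add_sq ℂ] at hmin
  have hre : ∀ a : ℤ → ℂ, |RCLike.re ⟪cut n a, (σ : ℂ) • cut n z⟫| ≤
      σ * ‖⟪win n z, cut n a⟫‖ := fun a => by
    refine (RCLike.abs_re_le_norm _).trans (le_of_eq ?_)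
    rw [inner_smul_right, norm_mul, Complex.norm_real, Real.norm_of_nonneg hσ.le, inner_win_cut,
      norm_inner_symm]
  have h1 := (abs_le.1 (hre (x - conv φ (observe σ x z)))).1
  have h2 := (abs_le.1 (hre (x - conv ψ (observe σ x z)))).2
  linarith

/-- The oracle part of the basic inequality. -/
theorem oracle_le (hσ : 0 < σ) (hϱ : 1 ≤ ϱ) (hu : 0 ≤ u) (hn : n = 2 * m)
    (hϕ : ϕ ∈ supportedOn 0 m) (hnorm : normTwo m ϕ ^ 2 ≤ ϱ / (m + 1))
    (hbias : ∀ t : ℤ, -(m : ℤ) ≤ t → t ≤ n → ‖x t - conv ϕ x t‖ ^ 2 ≤ ϱ * σ ^ 2 / (m + 1))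
    (hv : NoiseBound m n s ϱ σ ϰ u u' K ϕ x ε (win n z)) :
    ‖cut n (x - conv (conv ϕ ϕ) (observe σ x z))‖ ^ 2 +
        2 * σ * ‖⟪win n z, cut n (x - conv (conv ϕ ϕ) (observe σ x z))⟫‖ ≤
      108 * σ ^ 2 * (ϱ ^ 2 * (1 + u)) := by
  have hψ := conv_self_mem hn hϕ
  have hdec : cut n (x - conv (conv ϕ ϕ) (observe σ x z)) =
      cut n (x - conv (conv ϕ ϕ) x) - (σ : ℂ) • convOp n (conv ϕ ϕ) (win n z) := by
    rw [convOp_win hψ, conv_observe hψ, ← map_smul, ← map_sub]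
    congr 1
    abel
  have hb := normTwo_bias_le hn hσ hϱ hϕ hnorm hbias
  rw [← norm_cut] at hb
  have h1 := hv.bias
  have h2 := hv.quadOracle
  have h3 := hv.normOracle
  rw [norm_inner_symm] at h1
  set A := cut n (x - conv (conv ϕ ϕ) x)
  set B := convOp n (conv ϕ ϕ) (win n z)
  have hnB : ‖A - (σ : ℂ) • B‖ ^ 2 ≤ 2 * ‖A‖ ^ 2 + 2 * σ ^ 2 * ‖B‖ ^ 2 := by
    have h4 : ‖A - (σ : ℂ) • B‖ ≤ ‖A‖ + σ * ‖B‖ := by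
      refine (norm_sub_le _ _).trans (le_of_eq ?_)
      rw [norm_smul, Complex.norm_real, Real.norm_of_nonneg hσ.le]
    have h5 := pow_le_pow_left₀ (norm_nonneg _) h4 2
    nlinarith [sq_nonneg (‖A‖ - σ * ‖B‖)]
  have hin : ‖⟪win n z, A - (σ : ℂ) • B⟫‖ ≤ ‖⟪win n z, A⟫‖ + σ * ‖⟪win n z, B⟫‖ := by
    rw [inner_sub_right, inner_smul_right]
    refine (norm_sub_le _ _).trans (le_of_eq ?_)
    rw [norm_mul, Complex.norm_real, Real.norm_of_nonneg hσ.le]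
  have hA : ‖⟪win n z, A⟫‖ ≤ 6 * (ϱ * σ) * (1 + u) := by
    refine (abs_le_of_sq_le_sq' (h1.trans ?_) (by positivity)).2
    have : 1 + u ≤ (1 + u) ^ 2 := by nlinarith
    have h6 := mul_le_mul_of_nonneg_left this (by positivity : 0 ≤ (ϱ * σ) ^ 2)
    nlinarith [sq_nonneg ((ϱ * σ) * (1 + u))]
  have hϱu : ϱ * (1 + u) ≤ ϱ ^ 2 * (1 + u) := by gcongr; nlinarith
  have hϱ2 : ϱ ^ 2 ≤ ϱ ^ 2 * (1 + u) := le_mul_of_one_le_right (by positivity) (by linarith)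
  have hϱ3 : ϱ ≤ ϱ * (1 + u) := le_mul_of_one_le_right (by positivity) (by linarith)
  rw [hdec]
  have hin2 : ‖⟪win n z, A - (σ : ℂ) • B⟫‖ ≤ σ * (30 * (ϱ ^ 2 * (1 + u))) := by
    refine hin.trans ?_
    have : σ * ‖⟪win n z, B⟫‖ ≤ σ * (24 * (ϱ * (1 + u))) :=
      mul_le_mul_of_nonneg_left (by linarith) hσ.le
    have := mul_le_mul_of_nonneg_left hϱu hσ.le
    linarith
  have h7 : 2 * σ ^ 2 * ‖B‖ ^ 2 ≤ 2 * σ ^ 2 * (16 * (ϱ ^ 2 * (1 + u))) :=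
    mul_le_mul_of_nonneg_left (by linarith) (by positivity)
  have h8 : 2 * σ * ‖⟪win n z, A - (σ : ℂ) • B⟫‖ ≤ 2 * σ * (σ * (30 * (ϱ ^ 2 * (1 + u)))) :=
    mul_le_mul_of_nonneg_left hin2 (by positivity)
  have h9 := mul_le_mul_of_nonneg_left hϱ2 (by positivity : 0 ≤ σ ^ 2)
  linarith

/-- The part of the residual correlated with the noise outside of the shift-invariant subspace. -/
theorem inner_residual_le (hσ : 0 < σ) (hϱ : 1 ≤ ϱ) (hϰ : 0 ≤ ϰ) (hu : 0 ≤ u)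
    {S : Submodule ℂ (ℤ → ℂ)}
    (hS : S.map shift ≤ S) {xS : ℤ → ℂ} (hxS : xS ∈ S) (hx : x = xS + ε) (hK : K = S.map (cut n))
    (hφ : φ ∈ feasible n (2 * ϱ)) (hv : NoiseBound m n s ϱ σ ϰ u u' K ϕ x ε (win n z)) :
    ‖⟪win n z - K.starProjection (win n z), cut n (x - conv φ (observe σ x z))⟫‖ ≤
      6 * ϱ * (ϰ * σ) * √(1 + u) + σ * (2 * ϱ * (12 + 4 * √s + 8 * u')) := by
  set q := win n z - K.starProjection (win n z) with hq
  have hqK : ∀ k ∈ K, ⟪q, k⟫ = 0 := fun k hk => K.starProjection_inner_eq_zero _ _ hk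
  -- By shift invariance `xS - φ * xS` stays in `S` for any filter, including the noise-dependent
  -- one, so `q` is orthogonal to its restriction.
  have hshift : ∀ j : ℕ, (shift ^ j) xS ∈ S := fun j => by
    induction j with
    | zero => simpa using hxS
    | succ k ih =>
      rw [pow_succ', Module.End.mul_apply]
      exact hS (Submodule.mem_map_of_mem ih)
  have hxK : cut n (xS - conv φ xS) ∈ K := by
    rw [hK]
    refine Submodule.mem_map_of_mem (S.sub_mem hxS ?_)
    rw [conv_eq_sum_shift hφ.1]
    exact S.sum_mem fun j _ => S.smul_mem _ (hshift j)
  have hdec : cut n (x - conv φ (observe σ x z)) = cut n (xS - conv φ xS) + cut n ε -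
      ∑ j ∈ Finset.range (n + 1), φ j • cut n ((shift ^ j) ε) -
      (σ : ℂ) • convOp n φ (win n z) := by
    rw [convOp_win hφ.1, conv_observe hφ.1, hx, conv_add_right hφ.1, conv_eq_sum_shift hφ.1 ε]
    simp only [map_sub, map_add, map_sum, map_smul]
    abel
  -- Self-adjointness moves the projection from the noise to `a`. Applied to shifts of `ε`, this
  -- gives fixed linear forms of the noise.
  have hsym : ∀ a : Win n, ‖⟪q, a⟫‖ = ‖⟪a - K.starProjection a, win n z⟫‖ := fun a => by
    rw [norm_inner_symm, hq, inner_sub_right, inner_sub_left, K.inner_starProjection_left_eq_right]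
  have h1 : ‖⟪q, cut n ε⟫‖ ≤ 2 * (ϰ * σ) * √(1 + u) := by
    rw [hsym]
    refine (abs_le_of_sq_le_sq' (hv.residual.trans (le_of_eq ?_)) (by positivity)).2
    rw [mul_pow _ (√(1 + u)), Real.sq_sqrt (by positivity)]
    ring
  have hR := sq_norm_le_of_feasible hφ
  -- Cauchy-Schwarz over the shifts: the `n + 1` in `hv.shifts` is compensated by `(n + 1) ‖φ‖₂² ≤
  -- (2ϱ)²`.
  have h2 : ‖⟪q, ∑ j ∈ Finset.range (n + 1), φ j • cut n ((shift ^ j) ε)⟫‖ ≤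
      4 * ϱ * (ϰ * σ) * √(1 + u) := by
    rw [inner_sum]
    have h3 : ‖∑ j ∈ Finset.range (n + 1), ⟪q, φ j • cut n ((shift ^ j) ε)⟫‖ ≤
        ∑ j ∈ Finset.range (n + 1), ‖φ j‖ * ‖⟪cut n ((shift ^ j) ε) -
          K.starProjection (cut n ((shift ^ j) ε)), win n z⟫‖ := by
      refine (norm_sum_le _ _).trans (le_of_eq (Finset.sum_congr rfl fun j _ => ?_))
      rw [inner_smul_right, norm_mul, hsym]
    refine h3.trans ?_
    have hcs := Finset.sum_mul_sq_le_sq_mul_sq (Finset.range (n + 1)) (fun j => ‖φ (j : ℤ)‖)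
      fun j => ‖⟪cut n ((shift ^ j) ε) - K.starProjection (cut n ((shift ^ j) ε)), win n z⟫‖
    have hn2 : ∑ j ∈ Finset.range (n + 1), ‖φ (j : ℤ)‖ ^ 2 = normTwo n φ ^ 2 := by
      rw [normTwo, Real.sq_sqrt (by positivity)]
    rw [hn2] at hcs
    refine (abs_le_of_sq_le_sq' (hcs.trans ((mul_le_mul_of_nonneg_left hv.shifts
      (by positivity)).trans ?_)) (by positivity)).2
    have h5 : ((n : ℝ) + 1) * normTwo n φ ^ 2 ≤ (2 * ϱ) ^ 2 := by
      have := pow_le_pow_left₀ (mul_nonneg (Real.sqrt_nonneg _) (Real.sqrt_nonneg _)) hR 2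
      rwa [mul_pow, Real.sq_sqrt (by positivity)] at this
    rw [mul_pow _ (√(1 + u)), Real.sq_sqrt (by positivity)]
    have := mul_le_mul_of_nonneg_right h5 (by positivity : 0 ≤ 4 * (ϰ * σ) ^ 2 * (1 + u))
    linarith
  have h6 : ‖⟪q, convOp n φ (win n z)⟫‖ ≤ 2 * ϱ * (12 + 4 * √s + 8 * u') := by
    rw [convOp_win hφ.1]
    refine (norm_inner_cut_conv_le hφ.1 z q fun k hk => by
      rw [← convOp_win (fourierFilter_mem n k)]; exact hv.quad k hk).trans ?_
    have hsq : 0 < √((n : ℝ) + 1) := by positivity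
    have hsp := hφ.2
    rw [le_div_iff₀ hsq] at hsp
    have h7 : 0 ≤ 12 + 4 * √s + 8 * u' := by
      have h8 := (norm_nonneg _).trans (hv.quad 0 (by simp))
      have h9 : 4 * (√((n : ℝ) + 1) * (1 + √s)) + 8 * √((n : ℝ) + 1) * (1 + u') =
        √((n : ℝ) + 1) * (12 + 4 * √s + 8 * u') := by ring
      rw [h9] at h8
      exact nonneg_of_mul_nonneg_right h8 hsq
    have := mul_le_mul_of_nonneg_right hsp h7
    linarith
  rw [hdec, inner_sub_right, inner_sub_right, inner_add_right, hqK _ hxK, zero_add, inner_smul_right]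
  refine (norm_sub_le _ _).trans (add_le_add ((norm_sub_le _ _).trans ?_) ?_)
  · have h10 : (ϰ * σ) * √(1 + u) ≤ ϱ * ((ϰ * σ) * √(1 + u)) :=
      le_mul_of_one_le_left (by positivity) hϱ
    linarith
  · rw [norm_mul, Complex.norm_real, Real.norm_of_nonneg hσ.le]
    exact mul_le_mul_of_nonneg_left h6 hσ.le

/-- The `ℓ₂`-risk bound. -/
theorem normTwo_risk_le (hσ : 0 < σ) (hϱ : 1 ≤ ϱ) (hϰ : 0 ≤ ϰ) (hu : 0 ≤ u) (hu' : 0 ≤ u')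
    (hn : n = 2 * m)
    (hϕ : ϕ ∈ supportedOn 0 m) (hnorm : normTwo m ϕ ^ 2 ≤ ϱ / (m + 1))
    (hbias : ∀ t : ℤ, -(m : ℤ) ≤ t → t ≤ n → ‖x t - conv ϕ x t‖ ^ 2 ≤ ϱ * σ ^ 2 / (m + 1))
    {S : Submodule ℂ (ℤ → ℂ)}
    (hS : S.map shift ≤ S) {xS : ℤ → ℂ} (hxS : xS ∈ S) (hx : x = xS + ε) (hK : K = S.map (cut n))
    (hLS : IsConstrainedLS n (2 * ϱ) (observe σ x z) φ)
    (hv : NoiseBound m n s ϱ σ ϰ u u' K ϕ x ε (win n z)) :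
    ‖cut n (x - conv φ (observe σ x z))‖ ^ 2 ≤
      400 * σ ^ 2 * (ϱ ^ 2 * (1 + u) + ϱ * ϰ * √(1 + u) + s + ϱ * u') := by
  have hb := norm_sq_le_of_isConstrainedLS hσ hLS (feasible_conv_self hn hϕ hnorm)
  have ho := oracle_le hσ hϱ hu hn hϕ hnorm hbias hv
  have hr := inner_residual_le hσ hϱ hϰ hu hS hxS hx hK hLS.1 hv
  have hp := hv.proj
  set r := cut n (x - conv φ (observe σ x z))
  set p := K.starProjection (win n z)
  have hin : ‖⟪win n z, r⟫‖ ≤ ‖p‖ * ‖r‖ + ‖⟪win n z - p, r⟫‖ := by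
    have : ⟪win n z, r⟫ = ⟪p, r⟫ + ⟪win n z - p, r⟫ := by rw [inner_sub_left]; ring
    rw [this]
    exact (norm_add_le _ _).trans (add_le_add_left (norm_inner_le_norm _ _) _)
  have h1 : 2 * σ * ‖⟪win n z, r⟫‖ ≤ 2 * σ * (‖p‖ * ‖r‖ +
      (6 * ϱ * (ϰ * σ) * √(1 + u) + σ * (2 * ϱ * (12 + 4 * √s + 8 * u')))) :=
    mul_le_mul_of_nonneg_left (hin.trans (by linarith)) (by positivity)
  -- Half of `‖r‖²` is absorbed on the left; the rest costs `σ² (s + u)`.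
  have h2 : 2 * σ * (‖p‖ * ‖r‖) ≤ ‖r‖ ^ 2 / 2 + 2 * σ ^ 2 * ‖p‖ ^ 2 := by
    nlinarith [sq_nonneg (‖r‖ - 2 * σ * ‖p‖)]
  have h3 : 2 * σ ^ 2 * ‖p‖ ^ 2 ≤ 2 * σ ^ 2 * (4 * (s + u)) :=
    mul_le_mul_of_nonneg_left hp (by positivity)
  have hss : √(s : ℝ) ^ 2 = s := Real.sq_sqrt (by positivity)
  -- The term `ϱ √s`, due to the trace of the projected quadratic forms, is dominated by terms
  -- already in the bound.
  have h4 : ϱ * √s ≤ (ϱ ^ 2 + s) / 2 := by nlinarith [sq_nonneg (ϱ - √s)]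
  have h5 : ϱ ≤ ϱ ^ 2 := by nlinarith
  have h6 : 1 ≤ ϱ ^ 2 := by nlinarith
  have h7 : u ≤ ϱ ^ 2 * u := le_mul_of_one_le_left hu h6
  have h8 : 0 ≤ ϱ ^ 2 * u := by positivity
  have h9 : 0 ≤ ϱ * ϰ * √(1 + u) := by positivity
  have hs0 : (0 : ℝ) ≤ s := by positivity
  have hG : ‖r‖ ^ 2 / 2 ≤ σ ^ 2 * (108 * (ϱ ^ 2 * (1 + u)) + 8 * (s + u) +
      12 * (ϱ * ϰ * √(1 + u)) + 48 * ϱ + 16 * (ϱ * √s) + 32 * (ϱ * u')) := by linarith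
  have h10 := mul_le_mul_of_nonneg_left (show 108 * (ϱ ^ 2 * (1 + u)) + 8 * (s + u) +
      12 * (ϱ * ϰ * √(1 + u)) + 48 * ϱ + 16 * (ϱ * √s) + 32 * (ϱ * u') ≤
      172 * (ϱ ^ 2 * (1 + u)) + 12 * (ϱ * ϰ * √(1 + u)) + 16 * s + 32 * (ϱ * u') by linarith)
    (sq_nonneg σ)
  have h11 : 0 ≤ ϱ * u' := by positivity
  have h12 := mul_nonneg (sq_nonneg σ) (show 0 ≤ 56 * (ϱ ^ 2 * (1 + u)) +
    376 * (ϱ * ϰ * √(1 + u)) + 368 * s + 336 * (ϱ * u') by positivity)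
  linarith

/-- The pointwise risk bound. -/
theorem pointwise_risk_le (hσ : 0 < σ) (hϱ : 1 ≤ ϱ) (hϰ : 0 ≤ ϰ) (hu : 0 ≤ u) (hu' : 0 ≤ u')
    (hn : n = 2 * m)
    (hϕ : ϕ ∈ supportedOn 0 m) (hnorm : normTwo m ϕ ^ 2 ≤ ϱ / (m + 1))
    (hbias : ∀ t : ℤ, -(m : ℤ) ≤ t → t ≤ n → ‖x t - conv ϕ x t‖ ^ 2 ≤ ϱ * σ ^ 2 / (m + 1))
    {S : Submodule ℂ (ℤ → ℂ)}
    (hS : S.map shift ≤ S) {xS : ℤ → ℂ} (hxS : xS ∈ S) (hx : x = xS + ε) (hK : K = S.map (cut n))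
    (hLS : IsConstrainedLS n (2 * ϱ) (observe σ x z) φ)
    (hv : NoiseBound m n s ϱ σ ϰ u u' K ϕ x ε (win n z)) {t : ℤ} (htm : (m : ℤ) ≤ t)
    (htn : t ≤ n) :
    ‖x t - conv φ (observe σ x z) t‖ ^ 2 ≤
      4000 * (σ ^ 2 * ϱ / (n + 1)) *
        (ϱ ^ 2 * (1 + u) + ϱ * ϰ * √(1 + u) + s + ϱ * u') := by
  have hr := normTwo_risk_le hσ hϱ hϰ hu hu' hn hϕ hnorm hbias hS hxS hx hK hLS hv
  set G := ϱ ^ 2 * (1 + u) + ϱ * ϰ * √(1 + u) + s + ϱ * u' with hG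
  have hφ := hLS.1
  have hm : (0 : ℝ) < (m : ℝ) + 1 := by positivity
  have hN : (0 : ℝ) < (n : ℝ) + 1 := by positivity
  set y := observe σ x z with hy
  set h : ℤ → ℂ := x - conv ϕ x with hh
  -- The residual is split by `1 = ϕ + (1 - ϕ)`, and commutativity moves `1 - ϕ` past `φ` onto the
  -- signal and the noise.
  have hdec : x t - conv φ y t = conv ϕ (x - conv φ y) t + (h t - conv φ h t) -
      (σ : ℂ) * conv φ z t + (σ : ℂ) * conv φ (conv ϕ z) t := by
    have e1 : x - conv φ y = x - conv φ x - (σ : ℂ) • conv φ z := by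
      rw [hy, conv_observe hφ.1]; abel
    have e2 := congrFun e1 t
    rw [Pi.sub_apply] at e2
    rw [e2, e1, hh, conv_sub_right hφ.1, conv_sub_right hϕ, conv_sub_right hϕ,
      conv_smul_right hϕ, conv_conv_comm hφ.1 hϕ x, conv_conv_comm hφ.1 hϕ z]
    simp only [Pi.sub_apply, Pi.smul_apply, smul_eq_mul]
    ring
  have hmn : ϱ / (m + 1) ≤ 2 * (ϱ / (n + 1)) := by
    have hn' : (n : ℝ) = 2 * m := by exact_mod_cast hn
    rw [← mul_div_assoc, div_le_div_iff₀ hm hN, hn']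
    nlinarith
  -- smoothed residual
  have b1 : ‖conv ϕ (x - conv φ y) t‖ ^ 2 ≤ 2 * (ϱ / (n + 1)) * (400 * σ ^ 2 * G) := by
    refine (norm_conv_le_normTwo hϕ _ t).trans ?_
    -- Here `t ≥ m` keeps the averaging window inside `[0, n]`, where the `ℓ₂`-risk is known.
    have h1 : ∑ u ∈ Finset.Icc (t - m) t, ‖(x - conv φ y) u‖ ^ 2 ≤
        ‖cut n (x - conv φ y)‖ ^ 2 := by
      rw [norm_cut]
      exact sum_Icc_le_normTwo_sq n _ (by omega) htn
    exact mul_le_mul (hnorm.trans hmn) (h1.trans hr) (by positivity) (by positivity)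
  have hR := sq_norm_le_of_feasible hφ
  have hsp := hφ.2
  -- bias
  have b2 : ‖h t - conv φ h t‖ ^ 2 ≤ 18 * ϱ ^ 2 * (σ ^ 2 * (ϱ / (n + 1))) := by
    set M : ℝ := √(ϱ * σ ^ 2 / (m + 1)) with hM
    have hM2 : M ^ 2 = ϱ * σ ^ 2 / (m + 1) := Real.sq_sqrt (by positivity)
    have hM0 : 0 ≤ M := Real.sqrt_nonneg _
    have hhM : ∀ t : ℤ, -(m : ℤ) ≤ t → t ≤ n → ‖h t‖ ≤ M := fun t h1 h2 =>
      Real.le_sqrt_of_sq_le (hbias t h1 h2)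
    have h2 := hhM t (by omega) htn
    have h3 := norm_conv_le_of_bound hφ.1 h t fun u hu1 hu2 => hhM u (by omega) (by omega)
    have h4 := mul_le_mul_of_nonneg_right hR hM0
    have h5 := mul_le_mul_of_nonneg_right hϱ hM0
    have h6 : ‖h t - conv φ h t‖ ≤ 3 * ϱ * M := by
      refine (norm_sub_le _ _).trans ?_
      linarith
    refine (pow_le_pow_left₀ (norm_nonneg _) h6 2).trans ?_
    rw [mul_pow, hM2, mul_pow]
    have h7 := mul_le_mul_of_nonneg_left hmn (by positivity : 0 ≤ 9 * ϱ ^ 2 * σ ^ 2)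
    calc 3 ^ 2 * ϱ ^ 2 * (ϱ * σ ^ 2 / (m + 1)) = 9 * ϱ ^ 2 * σ ^ 2 * (ϱ / (m + 1)) := by ring
      _ ≤ _ := h7
      _ = _ := by ring
  -- stochastic terms
  have hB : (2 * ϱ / √((n : ℝ) + 1)) ^ 2 = 4 * ϱ * (ϱ / (n + 1)) := by
    rw [div_pow, Real.sq_sqrt hN.le]
    ring
  have b3 : ‖conv φ z t‖ ^ 2 ≤ 4 * ϱ * (ϱ / (n + 1)) * (4 * (1 + u')) := by
    have h1 := norm_conv_le_specNormOne hφ.1 z t (M := √(4 * (1 + u'))) fun k hk => by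
      apply Real.le_sqrt_of_sq_le
      rw [conv_eq_inner_row (fourierFilter_mem n k) (by omega) htn]
      have := hv.sup k hk t.toNat (Finset.mem_range.2 (by omega))
      rw [Int.toNat_of_nonneg (by omega)] at this
      linarith
    have h2 := h1.trans (mul_le_mul_of_nonneg_right hsp (Real.sqrt_nonneg _))
    refine (pow_le_pow_left₀ (norm_nonneg _) h2 2).trans (le_of_eq ?_)
    rw [mul_pow, hB, Real.sq_sqrt (by positivity)]
  -- Cauchy-Schwarz needs the energy of `ϕ * z` on `[t - n, t]`, contained in `[-m, n]` because `t ≥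
  -- m` and `n = 2m`.
  have b4 : ‖conv φ (conv ϕ z) t‖ ^ 2 ≤ 4 * ϱ * (ϱ / (n + 1)) * (16 * ϱ * (1 + u)) := by
    have h1 : ∑ i ∈ Finset.Icc (t - n) t, ‖conv ϕ z i‖ ^ 2 ≤ 4 * (4 * ϱ) * (1 + u) := by
      refine le_trans ?_ hv.normSimple
      refine (Finset.sum_le_sum_of_subset_of_nonneg
        (Finset.Icc_subset_Icc (by omega : -(m : ℤ) ≤ t - n) htn)
        fun _ _ _ => by positivity).trans (le_of_eq ?_)
      refine Finset.sum_congr rfl fun i hi => ?_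
      have := Finset.mem_Icc.1 hi
      rw [conv_eq_inner_row hϕ (by omega) this.2]
    have h2 := (normTwo_le_specNormOne hφ.1).trans hsp
    have h3 := pow_le_pow_left₀ (Real.sqrt_nonneg _) h2 2
    rw [hB] at h3
    refine (norm_conv_le_normTwo hφ.1 _ t).trans (mul_le_mul h3 (by linarith) (by positivity)
      (by positivity))
  have hsum : ‖x t - conv φ y t‖ ^ 2 ≤ 4 * (‖conv ϕ (x - conv φ y) t‖ ^ 2 +
      ‖h t - conv φ h t‖ ^ 2 + σ ^ 2 * ‖conv φ z t‖ ^ 2 +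
      σ ^ 2 * ‖conv φ (conv ϕ z) t‖ ^ 2) := by
    rw [hdec]
    have h1 : ‖conv ϕ (x - conv φ y) t + (h t - conv φ h t) -
        (σ : ℂ) * conv φ z t + (σ : ℂ) * conv φ (conv ϕ z) t‖ ≤ ‖conv ϕ (x - conv φ y) t‖ +
        ‖h t - conv φ h t‖ + σ * ‖conv φ z t‖ + σ * ‖conv φ (conv ϕ z) t‖ := by
      have hn1 : ∀ w : ℂ, ‖(σ : ℂ) * w‖ = σ * ‖w‖ := fun w => by
        rw [norm_mul, Complex.norm_real, Real.norm_of_nonneg hσ.le]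
      refine (norm_add_le _ _).trans ?_
      rw [hn1]
      refine add_le_add_left ((norm_sub_le _ _).trans ?_) _
      rw [hn1]
      exact add_le_add_left (norm_add_le _ _) _
    refine (pow_le_pow_left₀ (norm_nonneg _) h1 2).trans ?_
    set A := ‖conv ϕ (x - conv φ y) t‖
    set B := ‖h t - conv φ h t‖
    set D := ‖conv φ z t‖
    set F := ‖conv φ (conv ϕ z) t‖
    nlinarith [sq_nonneg (A - B), sq_nonneg (A - σ * D), sq_nonneg (A - σ * F),
      sq_nonneg (B - σ * D), sq_nonneg (B - σ * F), sq_nonneg (σ * D - σ * F)]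
  refine hsum.trans ?_
  have hσ2 : 0 ≤ σ ^ 2 := sq_nonneg σ
  have c3 := mul_le_mul_of_nonneg_left b3 hσ2
  have c4 := mul_le_mul_of_nonneg_left b4 hσ2
  set w := ϱ / ((n : ℝ) + 1) with hw
  have hw0 : 0 ≤ w := by positivity
  have hwσ : σ ^ 2 * ϱ / (n + 1) = σ ^ 2 * w := by rw [hw]; ring
  rw [hwσ]
  have hfin : 800 * G + 18 * ϱ ^ 2 + 16 * (ϱ * (1 + u')) + 64 * (ϱ ^ 2 * (1 + u)) ≤ 1000 * G := by
    have d1 : ϱ ≤ ϱ ^ 2 := by nlinarith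
    have d2 : 0 ≤ ϱ ^ 2 * u := by positivity
    have d3 : 0 ≤ ϱ * ϰ * √(1 + u) := by positivity
    have d4 : 0 ≤ ϱ * u' := by positivity
    have d5 : (0 : ℝ) ≤ s := by positivity
    rw [hG]
    linarith
  have := mul_le_mul_of_nonneg_left hfin (by positivity : 0 ≤ 4 * (σ ^ 2 * w))
  linarith

end Risk

/-! ### Probability of the noise conditions. -/

section Probability

open scoped ComplexInnerProductSpace

variable {m n s : ℕ} {ϱ σ ϰ u u' : ℝ} {K : Submodule ℂ (Win n)} {ϕ x ε : ℤ → ℂ}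

theorem measurableSet_noiseBound :
    MeasurableSet {v | NoiseBound m n s ϱ σ ϰ u u' K ϕ x ε v} := by
  have hC : ∀ φ : ℤ → ℂ, Continuous (convOp n φ) := fun φ =>
    (convOp n φ).continuous_of_finiteDimensional
  have h : {v | NoiseBound m n s ϱ σ ϰ u u' K ϕ x ε v} =
      {v | ‖K.starProjection v‖ ^ 2 ≤ 4 * (s + u)} ∩
      (⋂ k ∈ Finset.range (n + 1), {v | ‖⟪v - K.starProjection v, convOp n (fourierFilter n k) v⟫‖ ≤
        4 * (√((n : ℝ) + 1) * (1 + √s)) + 8 * √((n : ℝ) + 1) * (1 + u')}) ∩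
      {v | ∑ τ ∈ Finset.range (n + 1),
        ‖⟪cut n ((shift ^ τ) ε) - K.starProjection (cut n ((shift ^ τ) ε)), v⟫‖ ^ 2 ≤
          4 * ((n + 1) * (ϰ * σ) ^ 2) * (1 + u)} ∩
      {v | ‖⟪cut n ε - K.starProjection (cut n ε), v⟫‖ ^ 2 ≤ 4 * (ϰ * σ) ^ 2 * (1 + u)} ∩
      {v | ‖⟪cut n (x - conv (conv ϕ ϕ) x), v⟫‖ ^ 2 ≤ 4 * (8 * (ϱ * σ) ^ 2) * (1 + u)} ∩
      {v | ‖⟪v, convOp n (conv ϕ ϕ) v⟫‖ ≤ 4 * (2 * ϱ) + 8 * (2 * ϱ) * (1 + u)} ∩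
      {v | ‖convOp n (conv ϕ ϕ) v‖ ^ 2 ≤ 4 * (2 * ϱ) ^ 2 * (1 + u)} ∩
      {v | ∑ t ∈ Finset.Icc (-(m : ℤ)) n, ‖⟪row n ϕ t, v⟫‖ ^ 2 ≤ 4 * (4 * ϱ) * (1 + u)} ∩
      (⋂ k ∈ Finset.range (n + 1), ⋂ t ∈ Finset.range (n + 1),
        {v | ‖⟪row n (fourierFilter n k) t, v⟫‖ ^ 2 ≤ 4 * 1 * (1 + u')}) := by
    ext v
    simp only [Set.mem_inter_iff, Set.mem_iInter, Set.mem_ofPred_eq]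
    constructor
    · rintro ⟨h1, h2, h3, h4, h5, h6, h7, h8, h9⟩
      exact ⟨⟨⟨⟨⟨⟨⟨⟨h1, h2⟩, h3⟩, h4⟩, h5⟩, h6⟩, h7⟩, h8⟩, h9⟩
    · rintro ⟨⟨⟨⟨⟨⟨⟨⟨h1, h2⟩, h3⟩, h4⟩, h5⟩, h6⟩, h7⟩, h8⟩, h9⟩
      exact ⟨h1, h2, h3, h4, h5, h6, h7, h8, h9⟩
  rw [h]
  have hI : ∀ w : Win n, Continuous fun v => ‖⟪w, v⟫‖ := fun w =>
    (continuous_const.inner continuous_id).norm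
  have key : ∀ {f : Win n → ℝ} {c : ℝ}, Continuous f → MeasurableSet {v | f v ≤ c} :=
    fun hf => (isClosed_le hf continuous_const).measurableSet
  refine (((((((MeasurableSet.inter ?_ ?_).inter ?_).inter ?_).inter ?_).inter ?_).inter ?_).inter
    ?_).inter ?_
  · exact key (K.starProjection.continuous.norm.pow 2)
  · exact Finset.measurableSet_biInter _ fun k _ => key
      ((continuous_id.sub K.starProjection.continuous).inner (hC _)).norm
  · exact key (continuous_finsetSum _ fun τ _ => (hI _).pow 2)
  · exact key ((hI _).pow 2)
  · exact key ((hI _).pow 2)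
  · exact key (continuous_id.inner (hC _)).norm
  · exact key ((hC _).norm.pow 2)
  · exact key (continuous_finsetSum _ fun τ _ => (hI _).pow 2)
  · exact Finset.measurableSet_biInter _ fun k _ => Finset.measurableSet_biInter _ fun t _ =>
      key ((hI _).pow 2)

theorem norm_inner_sq_tail {ι : Type*} [Fintype ι] [DecidableEq ι] (w : EuclideanSpace ℂ ι)
    {V u : ℝ} (hV : ‖w‖ ^ 2 ≤ V) :
    (stdGaussian (EuclideanSpace ℂ ι)).real {v | 4 * V * (1 + u) < ‖⟪w, v⟫‖ ^ 2} ≤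
      Real.exp (-u) := by
  have h := sum_sq_inner_tail (Finset.univ : Finset Unit) (fun _ => w) (u := u) (by simpa using hV)
  simpa using h

/-- A union bound. At level `u` there are six conditions of weight `1` and one quadratic form of
weight `4`, in total `10`. At level `u'` there are `n + 1` quadratic forms of weight `4` and `(n +
1)²` linear forms. -/
theorem noiseBound_compl_le (hσ : 0 < σ) (hϱ : 1 ≤ ϱ) (hn : n = 2 * m)
    (hϕ : ϕ ∈ supportedOn 0 m) (hnorm : normTwo m ϕ ^ 2 ≤ ϱ / (m + 1))
    (hbias : ∀ t : ℤ, -(m : ℤ) ≤ t → t ≤ n → ‖x t - conv ϕ x t‖ ^ 2 ≤ ϱ * σ ^ 2 / (m + 1))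
    (hε : ∀ τ : ℕ, τ ≤ n → normTwo n ((shift ^ τ) ε) ≤ ϰ * σ) (hK : Module.finrank ℂ K ≤ s) :
    (stdGaussian (Win n)).real {v | ¬ NoiseBound m n s ϱ σ ϰ u u' K ϕ x ε v} ≤
      10 * Real.exp (-u) + 5 * ((n : ℝ) + 1) ^ 2 * Real.exp (-u') := by
  set γ := stdGaussian (Win n) with hγ
  have hcon : ∀ w : Win n, ‖w - K.starProjection w‖ ≤ ‖w‖ := fun w => by
    rw [← Submodule.starProjection_orthogonal_val]
    exact Submodule.norm_starProjection_apply_le _ w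
  have hψ := feasible_conv_self hn hϕ hnorm
  have hψR := sq_norm_le_of_feasible hψ
  have hψ0 := norm_zero_le_of_feasible hψ
  have hψF : ((n : ℝ) + 1) * normTwo n (conv ϕ ϕ) ^ 2 ≤ (2 * ϱ) ^ 2 := by
    have := pow_le_pow_left₀ (mul_nonneg (Real.sqrt_nonneg _) (Real.sqrt_nonneg _)) hψR 2
    rwa [mul_pow, Real.sq_sqrt (by positivity)] at this
  have hεK : ∀ τ : ℕ, τ ≤ n →
      ‖cut n ((shift ^ τ) ε) - K.starProjection (cut n ((shift ^ τ) ε))‖ ^ 2 ≤ (ϰ * σ) ^ 2 :=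
    fun τ hτ => pow_le_pow_left₀ (norm_nonneg _)
      ((hcon _).trans ((norm_cut n _).le.trans (hε τ hτ))) 2
  have p1 := starProjection_tail K hK (u := u)
  have p2 : ∀ k, γ.real {v | 4 * (√((n : ℝ) + 1) * (1 + √s)) + 8 * √((n : ℝ) + 1) * (1 + u') <
      ‖⟪v - K.starProjection v, convOp n (fourierFilter n k) v⟫‖} ≤ 4 * Real.exp (-u') := fun k => by
    refine inner_convOp_tail (fourierFilter_mem n k) K hK (Real.sqrt_nonneg _) ?_ ?_
    · rw [normTwo_fourierFilter, Real.sq_sqrt (by positivity), mul_one]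
    · rw [norm_fourierFilter ⟨le_rfl, by omega⟩, ← div_eq_mul_inv, Real.div_sqrt]
      exact le_of_eq (by ring)
  have p3 : γ.real {v | 4 * ((n + 1) * (ϰ * σ) ^ 2) * (1 + u) < ∑ τ ∈ Finset.range (n + 1),
      ‖⟪cut n ((shift ^ τ) ε) - K.starProjection (cut n ((shift ^ τ) ε)), v⟫‖ ^ 2} ≤
      Real.exp (-u) := by
    refine sum_sq_inner_tail _ _ ?_
    refine (Finset.sum_le_sum fun τ hτ => hεK τ (by have := Finset.mem_range.1 hτ; omega)).trans
      (le_of_eq ?_)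
    simp
  have p4 := norm_inner_sq_tail (u := u) _ (hεK 0 (Nat.zero_le _))
  simp only [pow_zero, Module.End.one_apply] at p4
  have hb := normTwo_bias_le hn hσ hϱ hϕ hnorm hbias
  rw [← norm_cut] at hb
  have p5 := norm_inner_sq_tail (u := u) _ hb
  -- With `K = ⊥` nothing is projected out, and the trace is just `(n + 1) (ϕ * ϕ)₀`.
  have p6 := inner_convOp_tail hψ.1 ⊥ (s := 0) (by simp) (u := u) (τ := 2 * ϱ)
    (by positivity) hψF (by simpa using hψ0)
  simp only [Submodule.starProjection_bot, zero_apply, sub_zero] at p6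
  have p7 := sum_sq_inner_tail _ (fun t : ℕ => row n (conv ϕ ϕ) t) (u := u)
    ((sum_norm_row_sq hψ.1).le.trans hψF)
  simp only [← norm_convOp_sq] at p7
  have p8 : γ.real {v | 4 * (4 * ϱ) * (1 + u) <
      ∑ t ∈ Finset.Icc (-(m : ℤ)) n, ‖⟪row n ϕ t, v⟫‖ ^ 2} ≤ Real.exp (-u) := by
    refine sum_sq_inner_tail _ _ ?_
    refine (Finset.sum_le_sum fun t ht => ?_).trans (b := ∑ t ∈ Finset.Icc (-(m : ℤ)) n,
      ϱ / ((m : ℝ) + 1)) ?_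
    · have := Finset.mem_Icc.1 ht
      rw [norm_row_sq hϕ (by omega) this.2]
      exact hnorm
    · rw [Finset.sum_const, Int.card_Icc, nsmul_eq_mul,
        show ((n : ℤ) + 1 - -(m : ℤ)).toNat = 3 * m + 1 by omega, ← mul_div_assoc,
        div_le_iff₀ (by positivity)]
      push_cast
      nlinarith [mul_nonneg (by linarith : 0 ≤ ϱ) (Nat.cast_nonneg (α := ℝ) m)]
  have p9 : ∀ k, ∀ t ∈ Finset.range (n + 1), γ.real {v | 4 * 1 * (1 + u') <
      ‖⟪row n (fourierFilter n k) (t : ℤ), v⟫‖ ^ 2} ≤ Real.exp (-u') := fun k t ht => by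
    have := Finset.mem_range.1 ht
    refine norm_inner_sq_tail _ (le_of_eq ?_)
    rw [norm_row_sq (fourierFilter_mem n k) (by omega) (by omega), normTwo_fourierFilter]
  have hsub : {v | ¬ NoiseBound m n s ϱ σ ϰ u u' K ϕ x ε v} ⊆
      {v | 4 * (s + u) < ‖K.starProjection v‖ ^ 2} ∪
      ((⋃ k ∈ Finset.range (n + 1), {v | 4 * (√((n : ℝ) + 1) * (1 + √s)) +
        8 * √((n : ℝ) + 1) * (1 + u') <
          ‖⟪v - K.starProjection v, convOp n (fourierFilter n k) v⟫‖}) ∪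
      ({v | 4 * ((n + 1) * (ϰ * σ) ^ 2) * (1 + u) < ∑ τ ∈ Finset.range (n + 1),
        ‖⟪cut n ((shift ^ τ) ε) - K.starProjection (cut n ((shift ^ τ) ε)), v⟫‖ ^ 2} ∪
      ({v | 4 * (ϰ * σ) ^ 2 * (1 + u) < ‖⟪cut n ε - K.starProjection (cut n ε), v⟫‖ ^ 2} ∪
      ({v | 4 * (8 * (ϱ * σ) ^ 2) * (1 + u) < ‖⟪cut n (x - conv (conv ϕ ϕ) x), v⟫‖ ^ 2} ∪
      ({v | 4 * (2 * ϱ) + 8 * (2 * ϱ) * (1 + u) < ‖⟪v, convOp n (conv ϕ ϕ) v⟫‖} ∪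
      ({v | 4 * (2 * ϱ) ^ 2 * (1 + u) < ‖convOp n (conv ϕ ϕ) v‖ ^ 2} ∪
      ({v | 4 * (4 * ϱ) * (1 + u) < ∑ t ∈ Finset.Icc (-(m : ℤ)) n, ‖⟪row n ϕ t, v⟫‖ ^ 2} ∪
      (⋃ k ∈ Finset.range (n + 1), ⋃ t ∈ Finset.range (n + 1),
        {v | 4 * 1 * (1 + u') < ‖⟪row n (fourierFilter n k) (t : ℤ), v⟫‖ ^ 2})))))))) := by
    intro v hv
    by_contra hcon
    simp only [Set.mem_union, Set.mem_iUnion, Set.mem_ofPred_eq, not_or, not_exists, not_lt]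
      at hcon
    obtain ⟨h1, h2, h3, h4, h5, h6, h7, h8, h9⟩ := hcon
    exact hv ⟨h1, h2, h3, h4, h5, h6, h7, h8, h9⟩
  have hU := fun A B : Set (Win n) => measureReal_union_le (μ := γ) A B
  have q2 : γ.real (⋃ k ∈ Finset.range (n + 1), {v | 4 * (√((n : ℝ) + 1) * (1 + √s)) +
        8 * √((n : ℝ) + 1) * (1 + u') <
          ‖⟪v - K.starProjection v, convOp n (fourierFilter n k) v⟫‖}) ≤
      ((n : ℝ) + 1) * (4 * Real.exp (-u')) := by
    refine (measureReal_biUnion_finset_le _ _).trans ((Finset.sum_le_sum fun k _ => p2 k).trans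
      (le_of_eq ?_))
    simp
  have q9 : γ.real (⋃ k ∈ Finset.range (n + 1), ⋃ t ∈ Finset.range (n + 1),
        {v | 4 * 1 * (1 + u') < ‖⟪row n (fourierFilter n k) (t : ℤ), v⟫‖ ^ 2}) ≤
      ((n : ℝ) + 1) * (((n : ℝ) + 1) * Real.exp (-u')) := by
    refine (measureReal_biUnion_finset_le _ _).trans ((Finset.sum_le_sum fun k _ =>
      (measureReal_biUnion_finset_le _ _).trans (Finset.sum_le_sum fun t ht => p9 k t ht)).trans
      (le_of_eq ?_))
    simp
  refine (measureReal_mono hsub).trans ?_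
  refine (hU _ _).trans (le_trans (add_le_add p1 ((hU _ _).trans (add_le_add q2 ((hU _ _).trans
    (add_le_add p3 ((hU _ _).trans (add_le_add p4 ((hU _ _).trans (add_le_add p5
    ((hU _ _).trans (add_le_add p6 ((hU _ _).trans (add_le_add p7 ((hU _ _).trans
    (add_le_add p8 q9))))))))))))))) ?_)
  have hE := Real.exp_pos (-u')
  have hN : (n : ℝ) + 1 ≤ ((n : ℝ) + 1) ^ 2 := by nlinarith [Nat.cast_nonneg (α := ℝ) n]
  have := mul_le_mul_of_nonneg_right hN hE.le
  linarith

end Probability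

/-! ### From deviation bounds to expectations. -/

section Expectation

variable {Ω : Type*} [MeasurableSpace Ω] {P : Measure Ω} [IsProbabilityMeasure P]

/-- A logarithmic deviation bound at all confidence levels controls the expectation. -/
theorem integral_le_of_log_tail {X : Ω → ℝ} (hX : AEStronglyMeasurable X P) (hX0 : ∀ ω, 0 ≤ X ω)
    {a b : ℝ} (hb : 0 < b)
    (h : ∀ α : ℝ, 0 < α → α < 1 → P.real {ω | a + b * Real.log (1 / α) < X ω} ≤ α) :
    Integrable X P ∧ ∫ ω, X ω ∂P ≤ a + b := by
  -- The normalized excess satisfies `P (W > t) ≤ exp (-t)`, by the choice `α = exp (-t)`, so its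
  -- mean is at most `1`.
  set W : Ω → ℝ := fun ω => max ((X ω - a) / b) 0 with hW
  have hWm : AEMeasurable W P := by
    have := hX.aemeasurable
    fun_prop
  have hW0 : ∀ ω, 0 ≤ W ω := fun ω => le_max_right _ _
  have hXW : ∀ ω, X ω ≤ a + b * W ω := fun ω => by
    have h1 : (X ω - a) / b ≤ W ω := le_max_left _ _
    rw [div_le_iff₀ hb] at h1
    linarith
  have htail : ∀ t ∈ Set.Ioi (0 : ℝ), P {ω | t < W ω} ≤ ENNReal.ofReal (Real.exp (-t)) :=
    fun t ht => by
      have ht : 0 < t := ht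
      have h1 := h (Real.exp (-t)) (Real.exp_pos _) (by simpa using ht)
      rw [one_div, ← Real.exp_neg, neg_neg, Real.log_exp] at h1
      rw [← ofReal_measureReal]
      refine ENNReal.ofReal_le_ofReal ((measureReal_mono fun ω hω => ?_).trans h1)
      have h2 : t < max ((X ω - a) / b) 0 := hω
      rcases lt_max_iff.1 h2 with h3 | h3
      · rw [lt_div_iff₀ hb] at h3
        change a + b * t < X ω
        linarith
      · exact absurd h3 (not_lt.2 ht.le)
  have hl : ∫⁻ ω, ENNReal.ofReal (W ω) ∂P ≤ 1 := by
    rw [lintegral_eq_lintegral_meas_lt P (ae_of_all _ hW0) hWm]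
    refine (setLIntegral_mono' measurableSet_Ioi htail).trans (le_of_eq ?_)
    rw [← ofReal_integral_eq_lintegral_ofReal (integrableOn_exp_neg_Ioi 0)
      (ae_of_all _ fun t => (Real.exp_pos _).le), integral_exp_neg_Ioi_zero, ENNReal.ofReal_one]
  have hWi : Integrable W P := by
    refine ⟨hWm.aestronglyMeasurable, ?_⟩
    rw [hasFiniteIntegral_iff_ofReal (ae_of_all _ hW0)]
    exact hl.trans_lt ENNReal.one_lt_top
  have hW1 : ∫ ω, W ω ∂P ≤ 1 := by
    rw [integral_eq_lintegral_of_nonneg_ae (ae_of_all _ hW0) hWi.1]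
    exact ENNReal.toReal_le_of_le_ofReal zero_le_one (by simpa using hl)
  have hi : Integrable (fun ω => a + b * W ω) P := (integrable_const _).add (hWi.const_mul _)
  have hXi : Integrable X P := hi.mono' hX (ae_of_all _ fun ω => by
    rw [Real.norm_of_nonneg (hX0 ω)]; exact hXW ω)
  refine ⟨hXi, (integral_mono hXi hi hXW).trans ?_⟩
  rw [integral_add (integrable_const _) (hWi.const_mul _), integral_const_mul]
  simp only [integral_const, probReal_univ, one_smul]
  nlinarith

end Expectation

/-! ### Choice of confidence levels and conclusion. -/

section Main

variable {Ω : Type*} [MeasurableSpace Ω] {P : Measure Ω} [IsProbabilityMeasure P]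
  {ζ : ℤ → Ω → ℂ} {m n s : ℕ} {σ ϱ ϰ : ℝ} {x : ℤ → ℂ}

/-- At these levels the union bound totals `10/32 + 5/16 = 5/8` of `α`. The last comparison is `16
(n+1)² / α ≤ (2n / α)⁴`, which uses `n ≥ 2`. -/
theorem log_levels_le {α : ℝ} (hα : 0 < α) (hα1 : α < 1) (hn : 2 ≤ n) :
    0 ≤ Real.log (1 / α) ∧ 0 ≤ Real.log (32 / α) ∧ 0 ≤ Real.log (16 * ((n : ℝ) + 1) ^ 2 / α) ∧
      1 + Real.log (32 / α) ≤ 5 * (1 + Real.log (1 / α)) ∧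
      Real.log (16 * ((n : ℝ) + 1) ^ 2 / α) ≤ 4 * Real.log (((n : ℝ) + n) / α) := by
  have hn' : (2 : ℝ) ≤ n := by exact_mod_cast hn
  have hL : 0 ≤ Real.log (1 / α) := Real.log_nonneg (by rw [le_div_iff₀ hα]; linarith)
  have h32 : Real.log 32 ≤ 4 := by
    rw [show (32 : ℝ) = 2 ^ 5 by norm_num, Real.log_pow]
    have := Real.log_two_lt_d9
    push_cast
    linarith
  have e1 : Real.log (32 / α) = Real.log 32 + Real.log (1 / α) := by
    rw [← Real.log_mul (by norm_num) (by positivity)]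
    congr 1
    ring
  have h32' : 0 ≤ Real.log (32 : ℝ) := Real.log_nonneg (by norm_num)
  refine ⟨hL, by rw [e1]; linarith, Real.log_nonneg ?_, by rw [e1]; linarith, ?_⟩
  · rw [le_div_iff₀ hα]
    nlinarith
  · rw [← Real.log_rpow (by positivity)]
    refine Real.log_le_log (by positivity) ?_
    norm_num
    rw [div_pow, div_le_div_iff₀ hα (by positivity)]
    have h1 : α ^ 4 ≤ α := by
      have : α ^ 3 ≤ 1 := pow_le_one₀ hα.le hα1.le
      nlinarith
    have h2 : 16 * ((n : ℝ) + 1) ^ 2 ≤ ((n : ℝ) + n) ^ 4 := by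
      have h3 : ((n : ℝ) + 1) ^ 2 ≤ ((n : ℝ) + n) ^ 2 := by gcongr; linarith
      have h4 : (16 : ℝ) ≤ ((n : ℝ) + n) ^ 2 := by nlinarith
      calc 16 * ((n : ℝ) + 1) ^ 2 ≤ ((n : ℝ) + n) ^ 2 * ((n : ℝ) + n) ^ 2 := by gcongr
        _ = _ := by ring
    exact mul_le_mul h2 h1 (by positivity) (by positivity)

/-- The pointwise risk bound holds on a noise set of probability at least `1 - α`. -/
theorem exists_noise_set (hζ : IsStdComplexNoise ζ P) (hm : 1 ≤ m) (hn : n = 2 * m) (hσ : 0 < σ)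
    (hϱ : 1 ≤ ϱ) (hϰ : 0 ≤ ϰ) (hsimple : IsSimple m n ϱ σ x)
    (hshift : NearShiftInvariant n n s ϰ σ x) {α : ℝ} (hα : 0 < α) (hα1 : α < 1) :
    ∃ Ξ : Set (ℤ → ℂ), MeasurableSet Ξ ∧ 1 - α ≤ P.real {ω | (fun t => ζ t ω) ∈ Ξ} ∧
      ∀ z ∈ Ξ, ∀ φ : ℤ → ℂ, IsConstrainedLS n (2 * ϱ) (observe σ x z) φ →
        ∀ t : ℤ, (m : ℤ) ≤ t → t ≤ n →
          ‖x t - conv φ (observe σ x z) t‖ ^ 2 ≤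
            20000 * (σ ^ 2 * ϱ / (n + 1)) *
              (ϱ ^ 2 * (1 + Real.log (1 / α)) + remainder n n s ϱ ϰ α) := by
  obtain ⟨ϕ, hϕ, hnorm, hbias⟩ := hsimple
  obtain ⟨S, hS, hfin, hrank, xS, hxS, ε, hx, hε⟩ := hshift
  obtain ⟨hL, hu, hu', h1, h2⟩ := log_levels_le (n := n) hα hα1 (by omega)
  set u := Real.log (32 / α) with hudef
  set u' := Real.log (16 * ((n : ℝ) + 1) ^ 2 / α) with hu'def
  -- Restriction to `[0, n]` is linear, so it cannot raise the dimension above `s`.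
  set K : Submodule ℂ (Win n) := S.map (cut n) with hK
  have hKs : Module.finrank ℂ K ≤ s := hrank ▸ Submodule.finrank_map_le (cut n) S
  have hmeas := measurableSet_noiseBound (m := m) (n := n) (s := s) (ϱ := ϱ) (σ := σ) (ϰ := ϰ)
    (u := u) (u' := u') (K := K) (ϕ := ϕ) (x := x) (ε := ε)
  refine ⟨win n ⁻¹' {v | NoiseBound m n s ϱ σ ϰ u u' K ϕ x ε v}, measurable_win n hmeas, ?_, ?_⟩
  · obtain ⟨hae, hmap⟩ := map_win_eq_stdGaussian hζ n
    have hp := noiseBound_compl_le (u := u) (u' := u') hσ hϱ hn hϕ hnorm hbias hε hKs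
    have e1 : Real.exp (-u) = α / 32 := by
      rw [hudef, ← Real.log_inv, Real.exp_log (by positivity), inv_div]
    have e2 : Real.exp (-u') = α / (16 * ((n : ℝ) + 1) ^ 2) := by
      rw [hu'def, ← Real.log_inv, Real.exp_log (by positivity), inv_div]
    have e3 : 10 * Real.exp (-u) + 5 * ((n : ℝ) + 1) ^ 2 * Real.exp (-u') = 5 / 8 * α := by
      rw [e1, e2]
      field_simp
      norm_num
    have e4 : P.real {ω | (fun t => ζ t ω) ∈ win n ⁻¹' {v | NoiseBound m n s ϱ σ ϰ u u' K ϕ x ε v}} =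
        (stdGaussian (Win n)).real {v | NoiseBound m n s ϱ σ ϰ u u' K ϕ x ε v} := by
      rw [← hmap, measureReal_def, measureReal_def, Measure.map_apply_of_aemeasurable hae hmeas]
      rfl
    have e5 := probReal_compl_eq_one_sub (μ := stdGaussian (Win n)) hmeas
    have e6 : (stdGaussian (Win n)).real {v | NoiseBound m n s ϱ σ ϰ u u' K ϕ x ε v}ᶜ ≤ 5 / 8 * α :=
      hp.trans e3.le
    rw [e4]
    linarith
  · intro z hz φ hLS t htm htn
    refine (pointwise_risk_le hσ hϱ hϰ hu hu' hn hϕ hnorm hbias hS hxS hx hK hLS hz htm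
      htn).trans ?_
    have hr : remainder n n s ϱ ϰ α = ϱ * Real.log (((n : ℝ) + n) / α) +
        ϱ * ϰ * √(1 + Real.log (1 / α)) + s := by
      rw [remainder, div_self (by positivity), mul_one]
    set L := Real.log (1 / α)
    set N := Real.log (((n : ℝ) + n) / α)
    have hsq : √(1 + u) ≤ 5 * √(1 + L) := by
      rw [show (5 : ℝ) = √(5 ^ 2) by rw [Real.sqrt_sq (by norm_num)], ← Real.sqrt_mul (by norm_num)]
      exact Real.sqrt_le_sqrt (by linarith)
    have k1 := mul_le_mul_of_nonneg_left h1 (by positivity : 0 ≤ ϱ ^ 2)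
    have k2 := mul_le_mul_of_nonneg_left hsq (by positivity : 0 ≤ ϱ * ϰ)
    have k3 := mul_le_mul_of_nonneg_left h2 (by positivity : 0 ≤ ϱ)
    have k4 : (0 : ℝ) ≤ s := by positivity
    have k5 : 0 ≤ ϱ * u' := by positivity
    rw [hr]
    have k6 : ϱ ^ 2 * (1 + u) + ϱ * ϰ * √(1 + u) + s + ϱ * u' ≤
        5 * (ϱ ^ 2 * (1 + L) + (ϱ * N + ϱ * ϰ * √(1 + L) + s)) := by linarith
    have := mul_le_mul_of_nonneg_left k6 (by positivity : 0 ≤ 4000 * (σ ^ 2 * ϱ / ((n : ℝ) + 1)))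
    linarith

theorem IsStdComplexNoise.aemeasurable {P : Measure Ω} (hζ : IsStdComplexNoise ζ P) (t : ℤ) :
    AEMeasurable (ζ t) P := by
  have h : ζ t = fun ω => ((ζ t ω).re : ℂ) + ((ζ t ω).im : ℂ) * Complex.I := by
    ext ω
    rw [Complex.re_add_im]
  rw [h]
  have h1 := (hζ.law_re t).aemeasurable
  have h2 := (hζ.law_im t).aemeasurable
  exact (Complex.measurable_ofReal.comp_aemeasurable h1).add
    ((Complex.measurable_ofReal.comp_aemeasurable h2).mul_const _)

theorem expected_risk_le (hζ : IsStdComplexNoise ζ P) (hm : 1 ≤ m) (hn : n = 2 * m) (hσ : 0 < σ)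
    (hϱ : 1 ≤ ϱ) (hϰ : 0 ≤ ϰ) (hsimple : IsSimple m n ϱ σ x)
    (hshift : NearShiftInvariant n n s ϰ σ x) {φ : Ω → ℤ → ℂ} (hφ : AEMeasurable φ P)
    (hLS : ∀ᵐ ω ∂P, IsConstrainedLS n (2 * ϱ) (observe σ x (fun t => ζ t ω)) (φ ω)) {t : ℤ}
    (htm : (m : ℤ) ≤ t) (htn : t ≤ n) :
    Integrable (fun ω => ‖x t - conv (φ ω) (observe σ x (fun t => ζ t ω)) t‖ ^ 2) P ∧
      ∫ ω, ‖x t - conv (φ ω) (observe σ x (fun t => ζ t ω)) t‖ ^ 2 ∂P ≤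
        60000 * (σ ^ 2 * ϱ / (n + 1)) * (ϱ ^ 2 + ϱ * Real.log n + ϱ * ϰ + s) := by
  set X : Ω → ℝ := fun ω => ‖x t - conv (φ ω) (observe σ x (fun t => ζ t ω)) t‖ ^ 2 with hX
  -- Almost surely the filter is supported on `[0, n]`, so the convolution agrees with a finite sum
  -- of measurable terms.
  have hXm : AEStronglyMeasurable X P := by
    have h1 : AEMeasurable (fun ω => ‖x t - ∑ j ∈ Finset.range (n + 1),
        φ ω j * (x (t - j) + (σ : ℂ) * ζ (t - j) ω)‖ ^ 2) P := by
      refine ((aemeasurable_const.sub (Finset.aemeasurable_fun_sum _ fun j _ => ?_)).norm).pow_const 2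
      exact ((measurable_pi_apply (j : ℤ)).comp_aemeasurable hφ).mul
        (aemeasurable_const.add ((hζ.aemeasurable _).const_mul _))
    refine h1.aestronglyMeasurable.congr ?_
    filter_upwards [hLS] with ω hω
    rw [hX]
    simp only
    rw [conv_eq_sum_range hω.1.1]
    rfl
  have hn2 : (2 : ℝ) ≤ n := by exact_mod_cast (by omega : 2 ≤ n)
  set κ : ℝ := 20000 * (σ ^ 2 * ϱ / ((n : ℝ) + 1)) with hκ
  have hκ0 : 0 < κ := by positivity
  set N := Real.log ((n : ℝ) + n) with hN
  -- With `log (2n / α) = N + L` and `√(1 + L) ≤ 1 + L`, where `L = log (1 / α)`, the bound becomes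
  -- affine in `L`, as `integral_le_of_log_tail` requires.
  have htail : ∀ α : ℝ, 0 < α → α < 1 → P.real {ω | κ * (ϱ ^ 2 + ϱ * N + ϱ * ϰ + s) +
      κ * (ϱ ^ 2 + ϱ + ϱ * ϰ) * Real.log (1 / α) < X ω} ≤ α := fun α hα hα1 => by
    obtain ⟨Ξ, hΞm, hΞ, hb⟩ := exists_noise_set hζ hm hn hσ hϱ hϰ hsimple hshift hα hα1
    set G : Set Ω := {ω | (fun t => ζ t ω) ∈ Ξ} with hG
    have hGm : NullMeasurableSet G P :=
      (aemeasurable_pi_lambda _ fun t => hζ.aemeasurable t).nullMeasurableSet_preimage hΞm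
    have hGc : P.real Gᶜ ≤ α := by
      rw [probReal_compl_eq_one_sub₀ hGm]
      linarith
    refine le_trans ?_ hGc
    refine ENNReal.toReal_mono (measure_ne_top _ _) (measure_mono_ae ?_)
    filter_upwards [hLS] with ω hω hωX hωG
    refine not_le.2 (show κ * (ϱ ^ 2 + ϱ * N + ϱ * ϰ + s) +
      κ * (ϱ ^ 2 + ϱ + ϱ * ϰ) * Real.log (1 / α) < X ω from hωX)
      ((hb _ hωG _ hω t htm htn).trans ?_)
    have hL : 0 ≤ Real.log (1 / α) := Real.log_nonneg (by rw [le_div_iff₀ hα]; linarith)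
    have hlog : Real.log (((n : ℝ) + n) / α) = N + Real.log (1 / α) := by
      rw [hN, ← Real.log_mul (by positivity) (by positivity)]
      congr 1
      ring
    rw [remainder, div_self (by positivity), mul_one, hlog]
    set L := Real.log (1 / α)
    have hsq : √(1 + L) ≤ 1 + L := by
      rw [Real.sqrt_le_left (by linarith)]
      nlinarith
    have k2 := mul_le_mul_of_nonneg_left hsq (by positivity : 0 ≤ ϱ * ϰ)
    have := mul_le_mul_of_nonneg_left (show ϱ ^ 2 * (1 + L) + (ϱ * (N + L) + ϱ * ϰ * √(1 + L) + s) ≤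
      (ϱ ^ 2 + ϱ * N + ϱ * ϰ + s) + (ϱ ^ 2 + ϱ + ϱ * ϰ) * L by linarith) hκ0.le
    linarith
  obtain ⟨hi, hE⟩ := integral_le_of_log_tail hXm (fun ω => by positivity) (by positivity) htail
  refine ⟨hi, hE.trans ?_⟩
  have hlog0 : 0 ≤ Real.log n := Real.log_nonneg (by linarith)
  -- Uses `2n ≤ n²`, valid since `n ≥ 2`.
  have hlogN : N ≤ 2 * Real.log n := by
    rw [hN, show (2 : ℝ) * Real.log n = Real.log ((n : ℝ) ^ 2) by rw [Real.log_pow]; norm_num]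
    exact Real.log_le_log (by positivity) (by nlinarith)
  have k1 := mul_le_mul_of_nonneg_left hlogN (by positivity : 0 ≤ ϱ)
  have k2 : ϱ ≤ ϱ ^ 2 := by nlinarith
  have k3 : 0 ≤ ϱ * ϰ := by positivity
  have k4 : (0 : ℝ) ≤ s := by positivity
  have k5 : 0 ≤ ϱ * Real.log n := by positivity
  have := mul_le_mul_of_nonneg_left (show (ϱ ^ 2 + ϱ * N + ϱ * ϰ + s) + (ϱ ^ 2 + ϱ + ϱ * ϰ) ≤
    3 * (ϱ ^ 2 + ϱ * Real.log n + ϱ * ϰ + s) by linarith) hκ0.le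
  rw [show 60000 * (σ ^ 2 * ϱ / ((n : ℝ) + 1)) = 3 * κ by rw [hκ]; ring]
  linarith

end Main

end LocalFilter

end

theorem mainTheorem3 :
    ∃ C : ℝ, 0 < C ∧
      ∀ (Ω : Type*) [MeasurableSpace Ω] (P : Measure Ω) [IsProbabilityMeasure P]
        (ζ : ℤ → Ω → ℂ), LocalFilter.IsStdComplexNoise ζ P →
      ∀ (m n s : ℕ) (σ ϱ ϰ : ℝ) (x : ℤ → ℂ),
        1 ≤ m → n = 2 * m → 0 < σ → 1 ≤ ϱ → 0 ≤ ϰ → 1 ≤ s → s ≤ n + 1 →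
        LocalFilter.IsSimple m n ϱ σ x →
        LocalFilter.NearShiftInvariant n n s ϰ σ x →
        (∀ α : ℝ, 0 < α → α < 1 →
          ∃ Ξ : Set (ℤ → ℂ), MeasurableSet Ξ ∧
            1 - α ≤ P.real {ω | (fun t => ζ t ω) ∈ Ξ} ∧
            ∀ z ∈ Ξ, ∀ φ : ℤ → ℂ,
              LocalFilter.IsConstrainedLS n (2 * ϱ) (LocalFilter.observe σ x z) φ →
              ∀ t : ℤ, (m : ℤ) ≤ t → t ≤ n →
                ‖x t - LocalFilter.conv φ (LocalFilter.observe σ x z) t‖ ^ 2 ≤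
                  C * (σ ^ 2 * ϱ / (n + 1)) *
                    (ϱ ^ 2 * (1 + Real.log (1 / α)) + LocalFilter.remainder n n s ϱ ϰ α)) ∧
        (∀ φ : Ω → ℤ → ℂ, AEMeasurable φ P →
          (∀ᵐ ω ∂P, LocalFilter.IsConstrainedLS n (2 * ϱ)
            (LocalFilter.observe σ x (fun t => ζ t ω)) (φ ω)) →
          ∀ t : ℤ, (m : ℤ) ≤ t → t ≤ n →
            Integrable (fun ω =>
              ‖x t - LocalFilter.conv (φ ω)
                (LocalFilter.observe σ x (fun t => ζ t ω)) t‖ ^ 2) P ∧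
            ∫ ω, ‖x t - LocalFilter.conv (φ ω)
                (LocalFilter.observe σ x (fun t => ζ t ω)) t‖ ^ 2 ∂P ≤
              C * (σ ^ 2 * ϱ / (n + 1)) * (ϱ ^ 2 + ϱ * Real.log n + ϱ * ϰ + s)) := by
  refine ⟨60000, by norm_num, ?_⟩
  intro Ω _ P _ ζ hζ m n s σ ϱ ϰ x hm hn hσ hϱ hϰ _ _ hsimple hshift
  refine ⟨fun α hα hα1 => ?_, fun φ hφ hLS t htm htn =>
    LocalFilter.expected_risk_le hζ hm hn hσ hϱ hϰ hsimple hshift hφ hLS htm htn⟩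
  obtain ⟨Ξ, hΞm, hΞ, hb⟩ :=
    LocalFilter.exists_noise_set hζ hm hn hσ hϱ hϰ hsimple hshift hα hα1
  refine ⟨Ξ, hΞm, hΞ, fun z hz φ hLS t htm htn => (hb z hz φ hLS t htm htn).trans ?_⟩
  obtain ⟨hL, _, hu', _, h2⟩ := LocalFilter.log_levels_le (n := n) hα hα1 (by omega)
  have hN : 0 ≤ Real.log (((n : ℝ) + n) / α) := by linarith
  -- Nonnegativity of the remainder allows the constant `20000` to be enlarged to the common
  -- `60000`.
  have hrem : 0 ≤ LocalFilter.remainder n n s ϱ ϰ α := by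
    rw [LocalFilter.remainder]
    positivity
  gcongr
  norm_num
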